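/- Let $k$ be a field. A standard graded $k$-algebra is a commutative graded ring $R=\bigoplus_{i\ge 0}R_i$ with $R_0=k$ that is generated as a $k$-algebra by $R_1$, where $\dim_k R_1<\infty$; we view $k=R/R_+$ as a graded $R$-module concentrated in degree $0$. For a finitely generated $\mathbb{Z}$-graded $R$-module $M$, let $\cdots\to F_1\to F_0\to M\to 0$ be its minimal graded free resolution, write $F_i=\bigoplus_{j\in\mathbb{Z}}R(-j)^{\beta_{i,j}(M)}$, and let $$\operatorname{reg}_R M=\sup\{\,j-i : \beta_{i,j}(M)\neq 0\,\}\in\mathbb{Z}\cup\{\pm\infty\}$$ (with $\operatorname{reg}_R 0=-\infty$). The algebra $R$ is called Koszul if it is standard graded and $\operatorname{reg}_R k=0$. Let $R\to S$ be a finite homomorphism of Koszul $k$-algebras, that is, a degree-preserving homomorphism of $k$-algebras making $S$ a finitely generated $R$-module. Let $M$ be a finitely generated $\mathbb{Z}$-graded $S$-module, regarded as a graded $R$-module through $R\to S$. Then $$\operatorname{reg}_S M\le \operatorname{reg}_R M.$$ -/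

import Mathlib

/-- `𝒜` makes `R` a standard graded `k`-algebra: `R` is a nonzero commutative graded ring with
`R₀ = k`, generated as a `k`-algebra by `R₁`, where `dim_k R₁ < ∞`. -/
structure IsStandardGraded {k R : Type*} [Field k] [CommRing R] [Algebra k R]
    (𝒜 : ℕ → Submodule k R) [GradedAlgebra 𝒜] : Prop where
  nontrivial : Nontrivial R
  degree_zero : 𝒜 0 = 1
  finite_degree_one : Module.Finite k (𝒜 1)
  generated : Algebra.adjoin k (𝒜 1 : Set R) = ⊤

/-- The `ℕ`-grading of `R` seen as a `ℤ`-grading, with `R_j = 0` for `j < 0`. -/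
def intGrading {k R : Type*} [Field k] [CommRing R] [Algebra k R]
    (𝒜 : ℕ → Submodule k R) : ℤ → Submodule k R
  | Int.ofNat n => 𝒜 n
  | Int.negSucc _ => ⊥

/-- `ℳ` is a `ℤ`-grading making the `R`-module `M` a graded `R`-module: `M = ⨁_j M_j` and
`R_i M_j ⊆ M_{i+j}`. -/
structure IsGradedModule {k R M : Type*} [Field k] [CommRing R] [Algebra k R]
    [AddCommGroup M] [Module k M] [Module R M]
    (𝒜 : ℕ → Submodule k R) (ℳ : ℤ → Submodule k M) : Prop where
  isInternal : DirectSum.IsInternal ℳ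
  smul_mem : ∀ (i : ℕ) (j : ℤ) (a : R) (x : M), a ∈ 𝒜 i → x ∈ ℳ j → a • x ∈ ℳ ((i : ℤ) + j)

/-- The degree `j` component of the graded free module `⨁_a R(-deg a)`, whose `a`-th basis
vector has degree `deg a`. -/
def freeGrading {k R : Type*} [Field k] [CommRing R] [Algebra k R]
    (𝒜 : ℕ → Submodule k R) {n : ℕ} (deg : Fin n → ℤ) (j : ℤ) : Submodule k (Fin n → R) :=
  Submodule.pi Set.univ (fun a => intGrading 𝒜 (j - deg a))

/-- A minimal graded free resolution `⋯ → F₁ → F₀ → M → 0` of the graded `R`-module `M`, by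
finitely generated graded free modules `F_i = ⨁_a R(-deg i a)`: the maps are homogeneous of
degree `0`, the augmented complex is exact, and `d(F_{i+1}) ⊆ 𝔪 F_i` with `𝔪 = R₊`. -/
structure MinimalGradedFreeResolution {k R M : Type*} [Field k] [CommRing R] [Algebra k R]
    [AddCommGroup M] [Module k M] [Module R M]
    (𝒜 : ℕ → Submodule k R) [GradedAlgebra 𝒜] (ℳ : ℤ → Submodule k M) where
  rank : ℕ → ℕ
  deg : (i : ℕ) → Fin (rank i) → ℤ
  d : (i : ℕ) → (Fin (rank (i + 1)) → R) →ₗ[R] (Fin (rank i) → R)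
  aug : (Fin (rank 0) → R) →ₗ[R] M
  d_homogeneous : ∀ i j x, x ∈ freeGrading 𝒜 (deg (i + 1)) j → d i x ∈ freeGrading 𝒜 (deg i) j
  aug_homogeneous : ∀ j x, x ∈ freeGrading 𝒜 (deg 0) j → aug x ∈ ℳ j
  aug_surjective : Function.Surjective aug
  exact_zero : Function.Exact (d 0) aug
  exact_succ : ∀ i, Function.Exact (d (i + 1)) (d i)
  minimal : ∀ i x b, d i x b ∈ (HomogeneousIdeal.irrelevant 𝒜).toIdeal

/-- The graded Betti number `β_{i,j}`: the number of summands `R(-j)` of `F_i`. -/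
def MinimalGradedFreeResolution.betti {k R M : Type*} [Field k] [CommRing R] [Algebra k R]
    [AddCommGroup M] [Module k M] [Module R M]
    {𝒜 : ℕ → Submodule k R} [GradedAlgebra 𝒜] {ℳ : ℤ → Submodule k M}
    (F : MinimalGradedFreeResolution 𝒜 ℳ) (i : ℕ) (j : ℤ) : ℕ :=
  (Finset.univ.filter (fun a : Fin (F.rank i) => F.deg i a = j)).card

/-- Castelnuovo-Mumford regularity `reg_R M = sup {j - i : β_{i,j}(M) ≠ 0}` of a finitely generated
graded `R`-module, as an extended real number (`⊥ = -∞` for `M = 0`). The minimal graded free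
resolution exists and is unique up to isomorphism, so it does not matter which one is taken. -/
noncomputable def regularity {k R M : Type*} [Field k] [CommRing R] [Algebra k R]
    [AddCommGroup M] [Module k M] [Module R M]
    (𝒜 : ℕ → Submodule k R) [GradedAlgebra 𝒜] (ℳ : ℤ → Submodule k M) : EReal :=
  sSup {t : EReal | ∃ (F : MinimalGradedFreeResolution 𝒜 ℳ) (i : ℕ) (j : ℤ),
    F.betti i j ≠ 0 ∧ t = (((j - (i : ℤ) : ℤ) : ℝ) : EReal)}

/-- The grading of the residue field `k = R/R₊`, concentrated in degree `0`. -/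
def residueGrading {k R : Type*} [Field k] [CommRing R] [Algebra k R]
    (𝒜 : ℕ → Submodule k R) [GradedAlgebra 𝒜] :
    ℤ → Submodule k (R ⧸ (HomogeneousIdeal.irrelevant 𝒜).toIdeal) :=
  fun j => if j = 0 then ⊤ else ⊥

/-- A Koszul `k`-algebra: a standard graded `k`-algebra `R` with `reg_R k = 0`. -/
structure IsKoszulAlgebra {k R : Type*} [Field k] [CommRing R] [Algebra k R]
    (𝒜 : ℕ → Submodule k R) [GradedAlgebra 𝒜] : Prop where
  standard : IsStandardGraded 𝒜
  regularity_residue : regularity 𝒜 (residueGrading 𝒜) = 0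

/-! Measure complexes by slope, that is internal degree minus homological degree. Differentials
raise the slope by one, and the regularity is the supremum of the slopes of the generators of a
minimal resolution. Let P and Q be minimal R-resolutions of M and k, let G and K be minimal
S-resolutions of M and k, and suppose that some generator g of G has slope larger than every
generator of P.

The homology of M ⊗_R Q is Tor^R(M, k), which P ⊗_R k computes as well, and P ⊗_R k vanishes in all
slopes ≥ σ(g). Hence M ⊗_R Q = M ⊗_S (S ⊗_R Q) is exact in those slopes (`exact_of_balance`). Since
S is Koszul, K has only slopes ≤ 0, so tensoring with K over S keeps this exactness (`exact_tw`).

On the other hand g ⊗ 1 in G ⊗ k lifts to a cycle of G ⊗ K, and a degree-zero generator q of Q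
carries it to a cycle of G ⊗ (S ⊗_R Q) ⊗ K. That complex is quasi-isomorphic to M ⊗ (S ⊗_R Q) ⊗ K,
so the cycle is a boundary. But taking the coefficient at g and q and augmenting K → k kills
boundaries, because G and S ⊗_R Q are minimal, while it sends this cycle to 1 (`not_exact`).

Both halves rest on `ConeExact.tw`: tensoring with a free complex in nonnegative homological degrees
preserves quasi-isomorphisms, one slope at a time. -/

/-- A graded module `X` over a graded ring `A` with a differential `d` raising the degree by one,
and a sign operator `ε` which anticommutes with `d`. -/
structure GradedDiff {A : Type*} [CommRing A] (gA : ℤ → AddSubgroup A)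
    (X : Type*) [AddCommGroup X] [Module A X] where
  d : X →ₗ[A] X
  ε : X →ₗ[A] X
  gr : ℤ → AddSubgroup X
  d_d : ∀ x, d (d x) = 0
  d_ε : ∀ x, d (ε x) = -ε (d x)
  d_mem : ∀ {s x}, x ∈ gr s → d x ∈ gr (s + 1)
  ε_mem : ∀ {s x}, x ∈ gr s → ε x ∈ gr s
  smul_mem : ∀ {u s a x}, a ∈ gA u → x ∈ gr s → a • x ∈ gr (s + u)

/-- A complex of graded free modules with a chosen homogeneous basis `I`: the basis element `i` has
homological degree `h i` and internal degree `σ i + h i`, and `m` is the matrix of the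
differential. -/
structure FreeData {A : Type*} [CommRing A] (gA : ℤ → AddSubgroup A) where
  I : Type
  h : I → ℕ
  σ : I → ℤ
  m : I → I →₀ A
  m_mem : ∀ l i, m l i ∈ gA (σ l - σ i + 1)
  h_of_ne : ∀ l i, m l i ≠ 0 → h l = h i + 1
  m_sq : ∀ l, Finsupp.linearCombination A m (m l) = 0

/-! ### Tensor products with based free complexes -/

namespace GradedDiff

section act

variable {A X Y I : Type*} [CommRing A] [AddCommGroup X] [Module A X] [AddCommGroup Y] [Module A Y]

/-- `act v x` is the element `x ⊗ v` of `X ⊗ A^(I) = X^(I)`. -/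
noncomputable def act (v : I →₀ A) : X →ₗ[A] (I →₀ X) :=
  Finsupp.linearCombination A (fun i => (Finsupp.lsingle i : X →ₗ[A] (I →₀ X))) v

lemma act_eq_sum (v : I →₀ A) (x : X) : act v x = v.sum fun i a => a • Finsupp.single i x := by
  simp [act, Finsupp.linearCombination_apply, Finsupp.sum, LinearMap.sum_apply]

@[simp]
lemma act_apply (v : I →₀ A) (x : X) (i : I) : act v x i = v i • x := by
  classical
  rw [act_eq_sum, Finsupp.sum, Finsupp.finsetSum_apply]
  simp only [Finsupp.smul_apply, Finsupp.single_apply, smul_ite, smul_zero]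
  rw [Finset.sum_ite_eq']
  split_ifs with h
  · rfl
  · rw [Finsupp.notMem_support_iff.mp h, zero_smul]

lemma mapRange_act (f : X →ₗ[A] Y) (v : I →₀ A) (x : X) :
    Finsupp.mapRange.linearMap f (act v x) = act v (f x) := by
  ext i
  simp

end act

variable {A X Y : Type*} [CommRing A] {gA : ℤ → AddSubgroup A} [AddCommGroup X] [Module A X]
  [AddCommGroup Y] [Module A Y]

/-- The differential of the tensor product of a complex with a based free complex. -/
noncomputable def twD (C : GradedDiff gA X) (F : FreeData gA) : (F.I →₀ X) →ₗ[A] (F.I →₀ X) :=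
  Finsupp.mapRange.linearMap C.d + Finsupp.lsum A (fun l => act (F.m l) ∘ₗ C.ε)

/-- The sign operator of the tensor product of a complex with a based free complex. -/
noncomputable def twε (C : GradedDiff gA X) (F : FreeData gA) : (F.I →₀ X) →ₗ[A] (F.I →₀ X) :=
  Finsupp.lsum A (fun l => (-1 : A) ^ F.h l • (Finsupp.lsingle l ∘ₗ C.ε))

variable (C : GradedDiff gA X) (F : FreeData gA)

lemma twD_single (l : F.I) (x : X) :
    C.twD F (Finsupp.single l x) = Finsupp.single l (C.d x) + act (F.m l) (C.ε x) := by
  simp [twD]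

lemma twε_single (l : F.I) (x : X) :
    C.twε F (Finsupp.single l x) = (-1 : A) ^ F.h l • Finsupp.single l (C.ε x) := by
  simp [twε]

lemma twε_apply (x : F.I →₀ X) (i : F.I) : C.twε F x i = (-1 : A) ^ F.h i • C.ε (x i) := by
  induction x using Finsupp.induction_linear with
  | zero => simp
  | add x y hx hy => simp [hx, hy]
  | single l x =>
    rw [twε_single]
    by_cases h : l = i
    · subst h; simp
    · simp [Finsupp.single_eq_of_ne' h]

lemma lsum_act (v : F.I →₀ A) (x : X) :
    Finsupp.lsum A (fun l => act (F.m l) ∘ₗ C.ε) (act v x) =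
      act (Finsupp.linearCombination A F.m v) (C.ε x) := by
  induction v using Finsupp.induction_linear with
  | zero => simp [act]
  | add v w hv hw => simp only [act, map_add, LinearMap.add_apply] at hv hw ⊢; rw [hv, hw]
  | single i a =>
    simp [act, Finsupp.linearCombination_single]

lemma twD_act (v : F.I →₀ A) (x : X) :
    C.twD F (act v x) = act v (C.d x) + act (Finsupp.linearCombination A F.m v) (C.ε x) := by
  rw [← lsum_act, ← mapRange_act]
  rfl

/-- The entries of `F.m l` sit one homological degree below `l`, which costs one sign. This is what
makes `ε` anticommute with the second summand of the differential. -/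
lemma twε_act (l : F.I) (x : X) :
    C.twε F (act (F.m l) x) = -((-1 : A) ^ F.h l • act (F.m l) (C.ε x)) := by
  ext i
  rw [twε_apply, Finsupp.neg_apply, Finsupp.smul_apply, act_apply, act_apply]
  by_cases h : F.m l i = 0
  · simp [h]
  · rw [F.h_of_ne l i h, pow_succ]
    simp

lemma mem_of_single {I B : Type*} [AddCommGroup B] {P : AddSubgroup B} (f : (I →₀ X) →+ B)
    (x : I →₀ X) (h : ∀ i, f (Finsupp.single i (x i)) ∈ P) : f x ∈ P := by
  conv => rw [← Finsupp.sum_single x]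
  rw [Finsupp.sum, map_sum]
  exact P.sum_mem fun i _ => h i

/-- The slope grading of the tensor product. -/
def twGr : ℤ → AddSubgroup (F.I →₀ X) := fun s =>
  { carrier := {x | ∀ i, x i ∈ C.gr (s - F.σ i)}
    add_mem' := fun hx hy i => (C.gr _).add_mem (hx i) (hy i)
    zero_mem' := fun _ => (C.gr _).zero_mem
    neg_mem' := fun hx i => (C.gr _).neg_mem (hx i) }

lemma single_mem_twGr {s : ℤ} {i : F.I} {x : X} (hx : x ∈ C.gr (s - F.σ i)) :
    Finsupp.single i x ∈ C.twGr F s := by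
  intro j
  by_cases h : i = j
  · subst h; simpa using hx
  · rw [Finsupp.single_eq_of_ne' h]; exact (C.gr _).zero_mem

/-- The tensor product of a complex with a based free complex. -/
noncomputable def tw : GradedDiff gA (F.I →₀ X) where
  d := C.twD F
  ε := C.twε F
  gr := C.twGr F
  d_d x := by
    induction x using Finsupp.induction_linear with
    | zero => simp
    | add x y hx hy => simp [hx, hy]
    | single l x =>
      -- The two mixed terms cancel because `ε` anticommutes with `d`; the others vanish by `d² = 0`
      -- in each factor.
      rw [twD_single, map_add, twD_single, twD_act, C.d_d, F.m_sq, C.d_ε]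
      simp [act]
  d_ε x := by
    induction x using Finsupp.induction_linear with
    | zero => simp
    | add x y hx hy => simp only [map_add, hx, hy]; abel
    | single l x =>
      rw [twε_single, map_smul, twD_single, twD_single, map_add, twε_single, twε_act, C.d_ε]
      simp [add_comm]
  d_mem {s x} hx := by
    refine mem_of_single (C.twD F).toAddMonoidHom x fun l => ?_
    change C.twD F _ ∈ _
    rw [twD_single]
    refine add_mem (C.single_mem_twGr F ?_) fun i => ?_
    · convert C.d_mem (hx l) using 2; ring
    · rw [act_apply]
      convert C.smul_mem (F.m_mem l i) (C.ε_mem (hx l)) using 2; ring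
  ε_mem {s x} hx i := by
    rw [twε_apply]
    obtain h | h := neg_one_pow_eq_or A (F.h i) <;> rw [h]
    · simpa using C.ε_mem (hx i)
    · simpa using C.ε_mem (hx i)
  smul_mem {u s a x} ha hx i := by
    rw [Finsupp.smul_apply]
    convert C.smul_mem ha (hx i) using 2; ring

lemma tw_d_single (l : F.I) (x : X) :
    (C.tw F).d (Finsupp.single l x) = Finsupp.single l (C.d x) + act (F.m l) (C.ε x) :=
  C.twD_single F l x

lemma tw_ε_apply (x : F.I →₀ X) (i : F.I) :
    (C.tw F).ε x i = (-1 : A) ^ F.h i • C.ε (x i) := C.twε_apply F x i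

lemma tw_ε_single (l : F.I) (x : X) :
    (C.tw F).ε (Finsupp.single l x) = (-1 : A) ^ F.h l • Finsupp.single l (C.ε x) :=
  C.twε_single F l x

/-- The degree of leading terms: above the height of the support, `d` is computed termwise. -/
lemma tw_d_apply_of_height {N : ℕ} {x : F.I →₀ X} (hx : ∀ i, N < F.h i → x i = 0) {i : F.I}
    (hi : N ≤ F.h i) : (C.tw F).d x i = C.d (x i) := by
  have : ∀ l, act (F.m l) (C.ε (x l)) i = 0 := by
    intro l
    rw [act_apply]
    by_cases h : F.m l i = 0
    · simp [h]
    · rw [hx l (by rw [F.h_of_ne l i h]; omega)]; simp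
  change (C.twD F) x i = _
  rw [twD, LinearMap.add_apply, Finsupp.add_apply, Finsupp.lsum_apply, Finsupp.sum,
    Finsupp.finsetSum_apply]
  simp only [LinearMap.comp_apply, this, Finset.sum_const_zero, add_zero]
  simp

/-- A chain map. -/
structure IsChainMap (C : GradedDiff gA X) (C' : GradedDiff gA Y) (φ : X →ₗ[A] Y) : Prop where
  map_d : ∀ x, φ (C.d x) = C'.d (φ x)
  map_ε : ∀ x, φ (C.ε x) = C'.ε (φ x)
  map_mem : ∀ {s x}, x ∈ C.gr s → φ x ∈ C'.gr s

variable {C} {C' : GradedDiff gA Y} {φ : X →ₗ[A] Y}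

lemma IsChainMap.tw (h : IsChainMap C C' φ) (F : FreeData gA) :
    IsChainMap (C.tw F) (C'.tw F) (Finsupp.mapRange.linearMap φ) where
  map_d x := by
    induction x using Finsupp.induction_linear with
    | zero => simp
    | add x y hx hy => simp only [map_add, hx, hy]
    | single l x =>
      rw [tw_d_single, map_add, mapRange_act, h.map_ε]
      simp [tw_d_single, h.map_d]
  map_ε x := by
    ext i
    simp [tw_ε_apply, h.map_ε]
  map_mem hx i := by
    simpa using h.map_mem (hx i)

/-- The mapping cone of `φ` is exact in the degrees satisfying `p`. -/
def ConeExact (p : ℤ → Prop) (C : GradedDiff gA X) (C' : GradedDiff gA Y) (φ : X →ₗ[A] Y) : Prop :=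
  ∀ s, p s → ∀ x ∈ C.gr (s + 1), ∀ y ∈ C'.gr s, C.d x = 0 → φ x = C'.d y →
    ∃ x' ∈ C.gr s, ∃ y' ∈ C'.gr (s - 1), C.d x' = x ∧ y = φ x' + C'.d y'

/-- Filter by the homological degree of `F`. On the top layer of the support the differential is
that of `C` or `C'`, so exactness of the original cone solves the problem there; subtracting the
solution lowers the height, and supports are finite. The layer at `i` is shifted by `σ i`, whence
`hp`. -/
theorem ConeExact.tw {p : ℤ → Prop} (h : ConeExact p C C' φ) (hφ : IsChainMap C C' φ)
    (F : FreeData gA) (hp : ∀ i s, p s → p (s - F.σ i)) :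
    ConeExact p (C.tw F) (C'.tw F) (Finsupp.mapRange.linearMap φ) := by
  intro s hs
  have hφF := hφ.tw F
  suffices H : ∀ N : ℕ, ∀ x ∈ (C.tw F).gr (s + 1), ∀ y ∈ (C'.tw F).gr s,
      (∀ i, N ≤ F.h i → x i = 0) → (∀ i, N ≤ F.h i → y i = 0) → (C.tw F).d x = 0 →
      Finsupp.mapRange.linearMap φ x = (C'.tw F).d y →
      ∃ x' ∈ (C.tw F).gr s, ∃ y' ∈ (C'.tw F).gr (s - 1), (C.tw F).d x' = x ∧
        y = Finsupp.mapRange.linearMap φ x' + (C'.tw F).d y' by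
    intro x hx y hy hdx hxy
    classical
    refine H ((x.support ∪ y.support).sup F.h + 1) x hx y hy ?_ ?_ hdx hxy
    · intro i hi
      by_contra hne
      have := Finset.le_sup (f := F.h)
        (Finset.mem_union_left y.support (Finsupp.mem_support_iff.mpr hne))
      omega
    · intro i hi
      by_contra hne
      have := Finset.le_sup (f := F.h)
        (Finset.mem_union_right x.support (Finsupp.mem_support_iff.mpr hne))
      omega
  intro N
  induction N with
  | zero =>
    intro x _ y _ hx hy _ _
    have hx : x = 0 := Finsupp.ext fun i => hx i (Nat.zero_le _)
    have hy : y = 0 := Finsupp.ext fun i => hy i (Nat.zero_le _)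
    exact ⟨0, zero_mem _, 0, zero_mem _, by simp [hx], by simp [hy]⟩
  | succ N ih =>
    intro x hx y hy hxN hyN hdx hxy
    -- Solve at every index of height `N`. The last clause imposes the solution 0 elsewhere and
    -- wherever there is nothing to solve, so that the choices have finite support.
    have key : ∀ i, ∃ x' ∈ C.gr (s - F.σ i), ∃ y' ∈ C'.gr (s - F.σ i - 1),
        (F.h i = N → C.d x' = x i ∧ y i = φ x' + C'.d y') ∧
        (x i = 0 ∧ y i = 0 ∨ F.h i ≠ N → x' = 0 ∧ y' = 0) := by
      intro i
      by_cases h0 : x i = 0 ∧ y i = 0 ∨ F.h i ≠ N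
      · refine ⟨0, zero_mem _, 0, zero_mem _, fun hi => ?_, fun _ => ⟨rfl, rfl⟩⟩
        obtain ⟨h1, h2⟩ | h0 := h0
        · simp [h1, h2]
        · exact absurd hi h0
      · have hi : F.h i = N := by by_contra hne; exact h0 (Or.inr hne)
        obtain ⟨x', hx', y', hy', e1, e2⟩ := h (s - F.σ i) (hp i s hs) (x i)
          (by convert hx i using 2; ring) (y i) (hy i)
          (by rw [← C.tw_d_apply_of_height F (N := N) (fun j hj => hxN j hj) hi.ge, hdx]; rfl)
          (by rw [← C'.tw_d_apply_of_height F (N := N) (fun j hj => hyN j hj) hi.ge, ← hxy]; simp)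
        exact ⟨x', hx', y', hy', fun _ => ⟨e1, e2⟩, fun h => absurd h h0⟩
    choose f hf g hg hfg hfg0 using key
    classical
    let x₁ : F.I →₀ X := Finsupp.onFinset (x.support ∪ y.support) f fun i hi => by
      by_contra hne
      simp only [Finset.mem_union, Finsupp.mem_support_iff, not_or, not_not] at hne
      exact hi (hfg0 i (Or.inl hne)).1
    let y₁ : F.I →₀ Y := Finsupp.onFinset (x.support ∪ y.support) g fun i hi => by
      by_contra hne
      simp only [Finset.mem_union, Finsupp.mem_support_iff, not_or, not_not] at hne
      exact hi (hfg0 i (Or.inl hne)).2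
    have hx₁ : x₁ ∈ (C.tw F).gr s := fun i => hf i
    have hy₁ : y₁ ∈ (C'.tw F).gr (s - 1) := fun i => by
      have := hg i
      rwa [sub_right_comm] at this
    have hx₁N : ∀ i, N < F.h i → x₁ i = 0 := fun i hi => (hfg0 i (Or.inr hi.ne')).1
    have hy₁N : ∀ i, N < F.h i → y₁ i = 0 := fun i hi => (hfg0 i (Or.inr hi.ne')).2
    -- The corrected pair is supported in heights below `N`.
    obtain ⟨x₂, hx₂, y₂, hy₂, e1, e2⟩ := ih (x - (C.tw F).d x₁)
      (sub_mem hx ((C.tw F).d_mem hx₁))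
      (y - Finsupp.mapRange.linearMap φ x₁ - (C'.tw F).d y₁)
      (sub_mem (sub_mem hy (hφF.map_mem hx₁)) (by simpa using (C'.tw F).d_mem hy₁))
      (fun i hi => by
        rw [Finsupp.sub_apply, C.tw_d_apply_of_height F hx₁N hi]
        rcases hi.eq_or_lt with hi | hi
        · rw [show x₁ i = f i from rfl, (hfg i hi.symm).1, sub_self]
        · rw [hx₁N i hi, hxN i hi]; simp)
      (fun i hi => by
        rw [Finsupp.sub_apply, Finsupp.sub_apply, C'.tw_d_apply_of_height F hy₁N hi]
        rcases hi.eq_or_lt with hi | hi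
        · rw [(hfg i hi.symm).2]; simp [x₁, y₁]
        · simp [hx₁N i hi, hy₁N i hi, hyN i hi])
      (by rw [map_sub, hdx, (C.tw F).d_d, sub_zero])
      (by rw [map_sub, map_sub, map_sub, hxy, (C'.tw F).d_d, hφF.map_d, sub_zero])
    refine ⟨x₁ + x₂, add_mem hx₁ hx₂, y₁ + y₂, add_mem hy₁ hy₂, ?_, ?_⟩
    · rw [map_add, e1]; abel
    · rw [map_add, map_add, sub_sub, sub_eq_iff_eq_add] at *
      rw [e2]; abel

end GradedDiff

/-! ### Symmetry of the tensor product and balancing of Tor -/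

namespace GradedDiff

/-- A graded module as a complex concentrated in homological degree `0`. -/
def ofModule {A X : Type*} [CommRing A] {gA : ℤ → AddSubgroup A} [AddCommGroup X] [Module A X]
    (gX : ℤ → AddSubgroup X)
    (h : ∀ {u s} {a : A} {x}, a ∈ gA u → x ∈ gX s → a • x ∈ gX (s + u)) : GradedDiff gA X where
  d := 0
  ε := LinearMap.id
  gr := gX
  d_d _ := rfl
  d_ε _ := by simp
  d_mem _ := zero_mem _
  ε_mem h := h
  smul_mem := h

variable {A : Type*} [CommRing A] {gA : ℤ → AddSubgroup A}

/-- The isomorphism `F ⊗ G ≅ G ⊗ F`. -/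
noncomputable def swap (F G : FreeData gA) : (F.I →₀ G.I →₀ A) →ₗ[A] (G.I →₀ F.I →₀ A) :=
  Finsupp.lsum A fun i => Finsupp.lsum A fun j =>
    (-1 : A) ^ (F.h i * G.h j) • (Finsupp.lsingle j ∘ₗ Finsupp.lsingle i)

lemma swap_single (F G : FreeData gA) (i : F.I) (j : G.I) (a : A) :
    swap F G (Finsupp.single i (Finsupp.single j a)) =
      (-1 : A) ^ (F.h i * G.h j) • Finsupp.single j (Finsupp.single i a) := by
  rw [swap, Finsupp.lsum_single, Finsupp.lsum_single]
  rfl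

lemma induction_single {I J : Type*} {P : (I →₀ J →₀ A) → Prop} (x : I →₀ J →₀ A) (h0 : P 0)
    (ha : ∀ x y, P x → P y → P (x + y))
    (hs : ∀ i j a, P (Finsupp.single i (Finsupp.single j a))) : P x := by
  induction x using Finsupp.induction_linear with
  | zero => exact h0
  | add x y hx hy => exact ha x y hx hy
  | single i x =>
    induction x using Finsupp.induction_linear with
    | zero => simpa using h0
    | add x y hx hy => rw [Finsupp.single_add]; exact ha _ _ hx hy
    | single j a => exact hs i j a

lemma swap_apply (F G : FreeData gA) (x : F.I →₀ G.I →₀ A) (j : G.I) (i : F.I) :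
    swap F G x j i = (-1 : A) ^ (F.h i * G.h j) * x i j := by
  classical
  induction x using induction_single with
  | h0 => simp
  | ha x y hx hy => simp [hx, hy, mul_add]
  | hs i' j' a =>
    rw [swap_single]
    by_cases hj : j' = j <;> by_cases hi : i' = i <;> simp_all

lemma swap_swap (F G : FreeData gA) (x : F.I →₀ G.I →₀ A) : swap G F (swap F G x) = x := by
  ext i j
  rw [swap_apply, swap_apply, ← mul_assoc, mul_comm (G.h j), ← mul_pow]
  simp

/-- Applying `G.m` lowers the second height by one, so the Koszul sign changes by `(-1) ^ F.h i`,
exactly the sign that `ε` contributes on the other side. -/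
lemma swap_single_act (F G : FreeData gA) (i : F.I) (j : G.I) (a : A) :
    swap F G (Finsupp.single i (act (G.m j) a)) =
      (-1 : A) ^ (F.h i * G.h j) • (-1 : A) ^ F.h i •
        act (G.m j) (Finsupp.single i a) := by
  ext j' i'
  rw [swap_apply]
  by_cases hi : i = i'
  · subst hi
    by_cases hm : G.m j j' = 0
    · simp [hm]
    · simp only [Finsupp.single_eq_same, act_apply, Finsupp.smul_apply, smul_eq_mul]
      have h1 : (-1 : A) ^ F.h i * (-1) ^ F.h i = 1 := by rw [← mul_pow]; simp
      rw [G.h_of_ne j j' hm, mul_add, mul_one, pow_add]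
      linear_combination -(-1 : A) ^ (F.h i * G.h j') * G.m j j' * a * h1
  · simp [Finsupp.single_eq_of_ne' hi]

lemma swap_act_single (F G : FreeData gA) (i : F.I) (j : G.I) (a : A) :
    swap F G (act (F.m i) (Finsupp.single j a)) =
      (-1 : A) ^ (F.h i * G.h j) • (-1 : A) ^ G.h j •
        Finsupp.single j (act (F.m i) a) := by
  have h := swap_single_act G F j i a
  apply_fun swap F G at h
  rw [swap_swap, map_smul, map_smul] at h
  rw [h, smul_smul, smul_smul, smul_smul, mul_comm (F.h i), ← pow_add, ← pow_add, ← pow_add,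
    Even.neg_one_pow ⟨G.h j * F.h i + G.h j, by ring⟩, one_smul]

variable [hgA : SetLike.GradedMul gA]

variable (gA) in
/-- The graded ring as a complex concentrated in homological degree `0`. -/
def unit : GradedDiff gA A :=
  ofModule gA fun {u s a x} ha hx => by
    rw [smul_eq_mul, mul_comm]; exact SetLike.GradedMul.mul_mem hx ha

/-- The complex of free modules given by a `FreeData`. -/
noncomputable abbrev free (F : FreeData gA) : GradedDiff gA (F.I →₀ A) := (unit gA).tw F

lemma free_d (F : FreeData gA) (x : F.I →₀ A) :
    (free F).d x = Finsupp.linearCombination A F.m x := by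
  induction x using Finsupp.induction_linear with
  | zero => simp
  | add x y hx hy => simp [hx, hy]
  | single l a =>
    rw [tw_d_single]
    ext i
    simp [unit, ofModule, Finsupp.linearCombination_single, mul_comm]

lemma swap_mem (F G : FreeData gA) {s : ℤ} {x : F.I →₀ G.I →₀ A}
    (hx : x ∈ ((free G).tw F).gr s) : swap F G x ∈ ((free F).tw G).gr s := by
  intro j i
  rw [swap_apply]
  have := hx i j
  rw [sub_right_comm] at this
  obtain h | h := neg_one_pow_eq_or A (F.h i * G.h j) <;> rw [h]
  · simpa using this
  · simpa using this

lemma swap_d (F G : FreeData gA) (x : F.I →₀ G.I →₀ A) :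
    swap F G (((free G).tw F).d x) = ((free F).tw G).d (swap F G x) := by
  induction x using induction_single with
  | h0 => simp
  | ha x y hx hy => simp [hx, hy]
  | hs i j a =>
    have hε (a : A) : (unit gA).ε a = a := rfl
    have hd (a : A) : (unit gA).d a = 0 := rfl
    rw [swap_single, map_smul, tw_d_single, tw_d_single, tw_ε_single, tw_d_single, tw_d_single,
      tw_ε_single]
    simp only [hε, hd, Finsupp.single_zero, zero_add, map_add, map_smul, smul_add,
      swap_single_act, swap_act_single]
    rw [add_comm]
    congr 1
    rw [smul_smul, smul_smul, mul_right_comm, ← mul_pow, neg_one_mul, neg_neg, one_pow, one_mul]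

variable {X Y : Type*} [AddCommGroup X] [Module A X] [AddCommGroup Y] [Module A Y]
  {C : GradedDiff gA X} {C' : GradedDiff gA Y} {F G : FreeData gA}

/-- If `F → C` and `G → C'` are resolutions and `F ⊗ C'` vanishes in degree `s`, then `C ⊗ G` is
exact in degree `s`. -/
theorem exact_of_balance {φ : (F.I →₀ A) →ₗ[A] X} {ψ : (G.I →₀ A) →ₗ[A] Y}
    (hφ : IsChainMap (free F) C φ) (hψ : IsChainMap (free G) C' ψ)
    (hφe : ConeExact (fun _ => True) (free F) C φ) (hψe : ConeExact (fun _ => True) (free G) C' ψ)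
    {s : ℤ} (h0 : ∀ z ∈ (C'.tw F).gr s, z = 0) {y : G.I →₀ X} (hy : y ∈ (C.tw G).gr s)
    (hdy : (C.tw G).d y = 0) : ∃ y' ∈ (C.tw G).gr (s - 1), y = (C.tw G).d y' := by
  -- Replace `y` by a cycle `x` of `F ⊗ G`. Its image in `F ⊗ C'` lies in a zero component, so `x`
  -- is a boundary because `F ⊗ G → F ⊗ C'` is a quasi-isomorphism.
  obtain ⟨x, hx, y', hy', hdx, e⟩ := hφe.tw hφ G (fun _ _ _ => trivial) s trivial 0 (zero_mem _) y hy
    (by simp) (by simp [hdy])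
  have hz := h0 _ ((hψ.tw F).map_mem (swap_mem G F hx))
  obtain ⟨w, hw, -, -, hdw, -⟩ := hψe.tw hψ F (fun _ _ _ => trivial) (s - 1) trivial
    (swap G F x) (by simpa using swap_mem G F hx) 0 (zero_mem _) (by rw [← swap_d, hdx, map_zero])
    (by rw [hz, map_zero])
  refine ⟨Finsupp.mapRange.linearMap φ (swap F G w) + y',
    add_mem ((hφ.tw G).map_mem (swap_mem F G hw)) hy', ?_⟩
  rw [e, map_add, ← (hφ.tw G).map_d, ← swap_d, hdw, swap_swap]

end GradedDiff

/-! ### Integer gradings of the ring and of its residue field -/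

section IntGrading

variable {k R : Type*} [Field k] [CommRing R] [Algebra k R] (𝒜 : ℕ → Submodule k R)

lemma eq_zero_of_mem_intGrading {u : ℤ} {a : R} (hu : u < 0) (ha : a ∈ intGrading 𝒜 u) : a = 0 := by
  obtain ⟨n, rfl⟩ := Int.eq_negSucc_of_lt_zero hu
  simpa [intGrading] using ha

/-- The `ℤ`-grading of `R` by additive subgroups. -/
def intGr (j : ℤ) : AddSubgroup R := (intGrading 𝒜 j).toAddSubgroup

lemma mem_intGr {j : ℤ} {a : R} : a ∈ intGr 𝒜 j ↔ a ∈ intGrading 𝒜 j := Iff.rfl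

lemma IsGradedModule.smul_mem_int {M : Type*} [AddCommGroup M] [Module k M] [Module R M]
    {ℳ : ℤ → Submodule k M} (h : IsGradedModule 𝒜 ℳ) {u s : ℤ} {a : R} {x : M}
    (ha : a ∈ intGrading 𝒜 u) (hx : x ∈ ℳ s) : a • x ∈ ℳ (s + u) := by
  obtain hu | hu := lt_or_ge u 0
  · rw [eq_zero_of_mem_intGrading 𝒜 hu ha, zero_smul]; exact zero_mem _
  · lift u to ℕ using hu
    rw [add_comm]
    exact h.smul_mem u s a x ha hx

variable [GradedAlgebra 𝒜]

instance intGr_gradedMul : SetLike.GradedMul (intGr 𝒜) where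
  mul_mem {i j a b} ha hb := by
    rw [mem_intGr] at *
    obtain hi | hi := lt_or_ge i 0
    · rw [eq_zero_of_mem_intGrading 𝒜 hi ha, zero_mul]; exact zero_mem _
    obtain hj | hj := lt_or_ge j 0
    · rw [eq_zero_of_mem_intGrading 𝒜 hj hb, mul_zero]; exact zero_mem _
    lift i to ℕ using hi
    lift j to ℕ using hj
    rw [← Nat.cast_add]
    exact SetLike.GradedMul.mul_mem (A := 𝒜) ha hb

lemma one_mem_intGrading : (1 : R) ∈ intGrading 𝒜 0 := SetLike.GradedOne.one_mem (A := 𝒜)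

lemma mem_irrelevant_of_pos {u : ℤ} {a : R} (hu : 0 < u) (ha : a ∈ intGrading 𝒜 u) :
    a ∈ (HomogeneousIdeal.irrelevant 𝒜).toIdeal := by
  lift u to ℕ using hu.le
  exact HomogeneousIdeal.mem_irrelevant_of_mem 𝒜 (by exact_mod_cast hu) ha

lemma mem_irrelevant_of_ne {u : ℤ} {a : R} (hu : u ≠ 0) (ha : a ∈ intGrading 𝒜 u) :
    a ∈ (HomogeneousIdeal.irrelevant 𝒜).toIdeal := by
  obtain hu | hu := hu.lt_or_gt
  · rw [eq_zero_of_mem_intGrading 𝒜 hu ha]; exact zero_mem _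
  · exact mem_irrelevant_of_pos 𝒜 hu ha

lemma smul_residue_eq_zero {a : R} (ha : a ∈ (HomogeneousIdeal.irrelevant 𝒜).toIdeal)
    (x : R ⧸ (HomogeneousIdeal.irrelevant 𝒜).toIdeal) : a • x = 0 := by
  obtain ⟨x, rfl⟩ := Ideal.Quotient.mk_surjective x
  rw [← Ideal.Quotient.mk_eq_mk, ← Submodule.Quotient.mk_smul, Submodule.Quotient.mk_eq_zero]
  exact Ideal.mul_mem_right _ _ ha

lemma residueGrading_smul_mem {u s : ℤ} {a : R} {x : R ⧸ (HomogeneousIdeal.irrelevant 𝒜).toIdeal}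
    (ha : a ∈ intGrading 𝒜 u) (hx : x ∈ residueGrading 𝒜 s) :
    a • x ∈ residueGrading 𝒜 (s + u) := by
  by_cases hu : u = 0
  · subst hu
    rw [add_zero]
    unfold residueGrading at *
    split_ifs at * with h
    · trivial
    · rw [(Submodule.mem_bot k).mp hx, smul_zero]; exact zero_mem _
  · rw [smul_residue_eq_zero 𝒜 (mem_irrelevant_of_ne 𝒜 hu ha)]; exact zero_mem _

end IntGrading

/-! ### Homogeneous components -/

section Projections

variable {k T U : Type*} [Field k] [AddCommGroup T] [Module k T] [AddCommGroup U] [Module k U]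

/-- `p j` is the projection of `T` onto the component of degree `j` of the grading `𝒯`. -/
structure IsProjections (𝒯 : ℤ → Submodule k T) (p : ℤ → T →ₗ[k] T) : Prop where
  mem : ∀ j x, p j x ∈ 𝒯 j
  same : ∀ j x, x ∈ 𝒯 j → p j x = x
  ne : ∀ i j x, i ≠ j → x ∈ 𝒯 j → p i x = 0
  iSup : ⨆ j, 𝒯 j = ⊤

/-- `f` is only additive because the maps in a resolution are `R`-linear, with no compatibility of
the `k`-action on the module assumed. -/
lemma IsProjections.map {𝒯 : ℤ → Submodule k T} {𝒰 : ℤ → Submodule k U} {p : ℤ → T →ₗ[k] T}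
    {q : ℤ → U →ₗ[k] U} (hp : IsProjections 𝒯 p) (hq : IsProjections 𝒰 q) (f : T →+ U)
    (hf : ∀ j x, x ∈ 𝒯 j → f x ∈ 𝒰 j) (j : ℤ) (x : T) : f (p j x) = q j (f x) := by
  have hx : x ∈ ⨆ j, 𝒯 j := hp.iSup ▸ Submodule.mem_top
  induction hx using Submodule.iSup_induction' with
  | mem i x hx =>
    by_cases h : j = i
    · subst h
      rw [hp.same _ _ hx, hq.same _ _ (hf _ _ hx)]
    · rw [hp.ne _ _ _ h hx, hq.ne _ _ _ h (hf _ _ hx), map_zero]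
  | zero => simp
  | add x y _ _ hx hy => simp [hx, hy]

lemma exists_isProjections {𝒯 : ℤ → Submodule k T} (h : DirectSum.IsInternal 𝒯) :
    ∃ p, IsProjections 𝒯 p := by
  classical
  let := h.chooseDecomposition
  refine ⟨fun j => (𝒯 j).subtype ∘ₗ DirectSum.component k ℤ (fun i => 𝒯 i) j ∘ₗ
    (DirectSum.decomposeLinearEquiv 𝒯).toLinearMap, ?_, ?_, ?_, ?_⟩
  · intro j x
    exact Subtype.prop _
  · intro j x hx
    exact DirectSum.decompose_of_mem_same 𝒯 hx
  · intro i j x hij hx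
    exact DirectSum.decompose_of_mem_ne 𝒯 hx hij.symm
  · exact h.submodule_iSup_eq_top

end Projections

section Free

variable {k R : Type*} [Field k] [CommRing R] [Algebra k R] (𝒜 : ℕ → Submodule k R)
  [GradedAlgebra 𝒜]

/-- The projection of `R` onto its component of degree `j : ℤ`. -/
def intProj : ℤ → R →ₗ[k] R
  | Int.ofNat n => GradedAlgebra.proj 𝒜 n
  | Int.negSucc _ => 0

lemma isProjections_intProj : IsProjections (intGrading 𝒜) (intProj 𝒜) where
  mem j x := by
    cases j with
    | ofNat n => exact SetLike.coe_mem _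
    | negSucc n => exact zero_mem _
  same j x hx := by
    cases j with
    | ofNat n => exact DirectSum.decompose_of_mem_same 𝒜 hx
    | negSucc n => exact (((Submodule.mem_bot k).mp hx)).symm
  ne i j x hij hx := by
    cases j with
    | ofNat n =>
      cases i with
      | ofNat m => exact DirectSum.decompose_of_mem_ne 𝒜 hx (fun h => hij (by rw [h]))
      | negSucc m => rfl
    | negSucc n => rw [(Submodule.mem_bot k).mp hx, map_zero]
  iSup := by
    rw [eq_top_iff, ← (DirectSum.Decomposition.isInternal 𝒜).submodule_iSup_eq_top]
    exact iSup_le fun n => le_iSup (intGrading 𝒜) (n : ℤ)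

lemma isProjections_free {n : ℕ} (deg : Fin n → ℤ) : IsProjections (freeGrading 𝒜 deg)
    (fun j => LinearMap.pi fun a => intProj 𝒜 (j - deg a) ∘ₗ LinearMap.proj a) where
  mem j x a _ := (isProjections_intProj 𝒜).mem _ _
  same j x hx := funext fun a => (isProjections_intProj 𝒜).same _ _ (hx a trivial)
  ne i j x hij hx := funext fun a =>
    (isProjections_intProj 𝒜).ne _ _ _ (by simpa using hij) (hx a trivial)
  iSup := by
    rw [eq_top_iff]
    intro x _
    rw [← Finset.univ_sum_single x]
    refine Submodule.sum_mem _ fun a _ => ?_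
    have hx : x a ∈ ⨆ j, intGrading 𝒜 j := (isProjections_intProj 𝒜).iSup ▸ Submodule.mem_top
    generalize x a = y at hx
    induction hx using Submodule.iSup_induction' with
    | mem i y hy =>
      refine Submodule.mem_iSup_of_mem (i + deg a) fun b _ => ?_
      by_cases h : b = a
      · subst h; simpa using hy
      · simp [h]
    | zero => simp
    | add y z _ _ hy hz => rw [Pi.single_add]; exact add_mem hy hz

lemma single_mem_freeGrading {n : ℕ} (deg : Fin n → ℤ) (a : Fin n) :
    Pi.single a 1 ∈ freeGrading 𝒜 deg (deg a) := by
  intro b _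
  by_cases h : b = a
  · subst h; simpa using one_mem_intGrading 𝒜
  · simp [h]

end Free

/-! ### A minimal resolution as a based free complex resolving the module -/

namespace MinimalGradedFreeResolution

variable {k R M : Type*} [Field k] [CommRing R] [Algebra k R]
    [AddCommGroup M] [Module k M] [Module R M]
    {𝒜 : ℕ → Submodule k R} [GradedAlgebra 𝒜] {ℳ : ℤ → Submodule k M}
    (F : MinimalGradedFreeResolution 𝒜 ℳ)

/-- The inclusion of the module of homological degree `n`. -/
noncomputable def incl (n : ℕ) : (Fin (F.rank n) → R) →ₗ[R] ((Σ n, Fin (F.rank n)) →₀ R) :=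
  ∑ a, Finsupp.lsingle ⟨n, a⟩ ∘ₗ LinearMap.proj a

/-- The component of homological degree `n`. -/
noncomputable def comp (n : ℕ) : ((Σ n, Fin (F.rank n)) →₀ R) →ₗ[R] (Fin (F.rank n) → R) :=
  LinearMap.pi fun a => Finsupp.lapply ⟨n, a⟩

@[simp]
lemma comp_apply (n : ℕ) (x : (Σ n, Fin (F.rank n)) →₀ R) (a : Fin (F.rank n)) :
    F.comp n x a = x ⟨n, a⟩ := rfl

lemma incl_apply (n : ℕ) (v : Fin (F.rank n) → R) (a : Fin (F.rank n)) :
    F.incl n v ⟨n, a⟩ = v a := by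
  classical
  simp [incl, LinearMap.sum_apply, Finsupp.finsetSum_apply, Finsupp.single_apply]

lemma incl_apply_ne {n n' : ℕ} (h : n ≠ n') (v : Fin (F.rank n) → R) (a : Fin (F.rank n')) :
    F.incl n v ⟨n', a⟩ = 0 := by
  classical
  rw [incl, LinearMap.sum_apply, Finsupp.finsetSum_apply]
  refine Finset.sum_eq_zero fun b _ => ?_
  simp only [LinearMap.comp_apply, Finsupp.lsingle_apply]
  exact Finsupp.single_eq_of_ne' fun e => h (congrArg Sigma.fst e)

lemma incl_single (n : ℕ) (a : Fin (F.rank n)) (r : R) :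
    F.incl n (Pi.single a r) = Finsupp.single ⟨n, a⟩ r := by
  ext ⟨n', b⟩
  by_cases h : n = n'
  · subst h
    rw [incl_apply]
    by_cases hb : b = a
    · subst hb; simp
    · rw [Pi.single_eq_of_ne hb, Finsupp.single_eq_of_ne]
      simpa using hb
  · rw [F.incl_apply_ne h, Finsupp.single_eq_of_ne]
    exact fun e => h (congrArg Sigma.fst e).symm

/-- The matrix of the differential. -/
noncomputable def matrix : (Σ n, Fin (F.rank n)) → ((Σ n, Fin (F.rank n)) →₀ R)
  | ⟨0, _⟩ => 0
  | ⟨n + 1, a⟩ => F.incl n (F.d n (Pi.single a 1))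

lemma linearCombination_incl (n : ℕ) (v : Fin (F.rank (n + 1)) → R) :
    Finsupp.linearCombination R F.matrix (F.incl (n + 1) v) = F.incl n (F.d n v) := by
  refine LinearMap.congr_fun (f := Finsupp.linearCombination R F.matrix ∘ₗ F.incl (n + 1))
    (g := F.incl n ∘ₗ F.d n) (LinearMap.pi_ext' fun a => LinearMap.ext_ring ?_) v
  simp [incl_single, matrix]

lemma linearCombination_incl_zero (v : Fin (F.rank 0) → R) :
    Finsupp.linearCombination R F.matrix (F.incl 0 v) = 0 := by
  refine LinearMap.congr_fun (f := Finsupp.linearCombination R F.matrix ∘ₗ F.incl 0)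
    (g := 0) (LinearMap.pi_ext' fun a => LinearMap.ext_ring ?_) v
  simp [incl_single, matrix]

/-- The based free complex of a minimal graded free resolution. -/
noncomputable abbrev toFreeData : FreeData (intGr 𝒜) where
  I := Σ n, Fin (F.rank n)
  h i := i.1
  σ i := F.deg i.1 i.2 - i.1
  m := F.matrix
  m_mem := by
    rintro ⟨l, a⟩ ⟨n, b⟩
    obtain _ | l := l
    · exact zero_mem _
    by_cases h : l = n
    · subst h
      simp only [matrix, incl_apply]
      have := F.d_homogeneous l _ _ (single_mem_freeGrading 𝒜 _ a) b trivial
      rwa [mem_intGr, show F.deg (l + 1) a - ((l + 1 : ℕ) : ℤ) - (F.deg l b - l) + 1 =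
        F.deg (l + 1) a - F.deg l b by push_cast; ring]
    · simp only [matrix]
      rw [F.incl_apply_ne h]
      exact zero_mem _
  h_of_ne := by
    rintro ⟨l, a⟩ ⟨n, b⟩ hne
    obtain _ | l := l
    · exact absurd rfl hne
    by_contra h
    exact hne (F.incl_apply_ne (fun e => h (by simp [e])) _ _)
  m_sq := by
    rintro ⟨l, a⟩
    obtain _ | _ | l := l
    · simp [matrix]
    · exact F.linearCombination_incl_zero _
    · refine (F.linearCombination_incl l _).trans ?_
      rw [(F.exact_succ l).apply_apply_eq_zero, map_zero]

lemma matrix_mem_irrelevant (i j : Σ n, Fin (F.rank n)) :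
    F.matrix i j ∈ (HomogeneousIdeal.irrelevant 𝒜).toIdeal := by
  obtain ⟨_ | l, a⟩ := i
  · exact zero_mem _
  · obtain ⟨n, b⟩ := j
    by_cases h : l = n
    · subst h
      simp only [matrix, incl_apply]
      exact F.minimal _ _ _
    · simp only [matrix]
      rw [F.incl_apply_ne h]
      exact zero_mem _

/-- The augmentation of the based free complex of a resolution. -/
noncomputable def augment : (F.toFreeData.I →₀ R) →ₗ[R] M := F.aug ∘ₗ F.comp 0

lemma comp_linearCombination (n : ℕ) (x : (Σ n, Fin (F.rank n)) →₀ R) :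
    F.comp n (Finsupp.linearCombination R F.matrix x) = F.d n (F.comp (n + 1) x) := by
  induction x using Finsupp.induction_linear with
  | zero => simp
  | add x y hx hy => simp [hx, hy]
  | single i a =>
    obtain ⟨l, b⟩ := i
    rw [Finsupp.linearCombination_single, map_smul]
    have hne : ∀ {p q : ℕ} (h : p ≠ q) (b : Fin (F.rank p)),
        F.comp q (Finsupp.single ⟨p, b⟩ a) = 0 := by
      intro p q h b
      ext c
      exact Finsupp.single_eq_of_ne' fun e => h (congrArg Sigma.fst e)
    obtain _ | l := l
    · rw [hne (by omega)]
      simp [matrix]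
    · by_cases h : l = n
      · subst h
        have : F.comp (l + 1) (Finsupp.single ⟨l + 1, b⟩ a) = a • Pi.single b 1 := by
          ext c
          by_cases hc : c = b
          · subst hc; simp
          · rw [comp_apply, Finsupp.single_eq_of_ne (by simpa using hc)]
            simp [hc]
        rw [this, map_smul]
        congr 1
        ext c
        simp [matrix, incl_apply]
      · rw [hne (by omega), map_zero]
        ext c
        simp [matrix, F.incl_apply_ne h]

variable (hsm : ∀ {u s : ℤ} {a : R} {x : M}, a ∈ intGrading 𝒜 u → x ∈ ℳ s → a • x ∈ ℳ (s + u))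

/-- The resolved module as a complex. -/
def target (_F : MinimalGradedFreeResolution 𝒜 ℳ)
    (hsm : ∀ {u s : ℤ} {a : R} {x : M}, a ∈ intGrading 𝒜 u → x ∈ ℳ s → a • x ∈ ℳ (s + u)) :
    GradedDiff (intGr 𝒜) M :=
  GradedDiff.ofModule (fun j => (ℳ j).toAddSubgroup) hsm

lemma comp_mem {s : ℤ} {x : F.toFreeData.I →₀ R} (hx : x ∈ (GradedDiff.free F.toFreeData).gr s)
    (n : ℕ) : F.comp n x ∈ freeGrading 𝒜 (F.deg n) (s + n) := by
  intro a _
  have h : x ⟨n, a⟩ ∈ intGrading 𝒜 (s - (F.deg n a - n)) := hx ⟨n, a⟩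
  rwa [show s - (F.deg n a - n) = s + n - F.deg n a by ring] at h

lemma isChainMap_augment :
    (GradedDiff.free F.toFreeData).IsChainMap (F.target hsm) F.augment where
  map_d x := by
    rw [GradedDiff.free_d]
    exact (congrArg F.aug (F.comp_linearCombination 0 x)).trans (F.exact_zero.apply_apply_eq_zero _)
  map_ε x := by
    refine congrArg F.aug (funext fun a => ?_)
    refine (GradedDiff.tw_ε_apply (GradedDiff.unit (intGr 𝒜)) F.toFreeData x ⟨0, a⟩).trans ?_
    exact (congrArg (· • x ⟨0, a⟩) (pow_zero _)).trans (one_smul _ _)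
  map_mem {s x} hx := by
    have h := F.comp_mem hx 0
    rw [Nat.cast_zero, add_zero] at h
    exact F.aug_homogeneous _ _ h

lemma eq_of_comp {x y : F.toFreeData.I →₀ R} (h : ∀ n, F.comp n x = F.comp n y) : x = y :=
  Finsupp.ext fun ⟨n, a⟩ => congrFun (h n) a

lemma comp_incl (n : ℕ) (v : Fin (F.rank n) → R) : F.comp n (F.incl n v) = v :=
  funext fun a => F.incl_apply n v a

lemma comp_incl_ne {n n' : ℕ} (h : n ≠ n') (v : Fin (F.rank n) → R) :
    F.comp n' (F.incl n v) = 0 :=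
  funext fun a => F.incl_apply_ne h v a

lemma incl_mem {s : ℤ} {n : ℕ} {v : Fin (F.rank n) → R} (hv : v ∈ freeGrading 𝒜 (F.deg n) (s + n)) :
    F.incl n v ∈ (GradedDiff.free F.toFreeData).gr s := by
  rintro ⟨n', a⟩
  by_cases h : n = n'
  · subst h
    rw [incl_apply]
    have := hv a trivial
    change _ ∈ intGrading 𝒜 (s - (F.deg n a - n))
    rwa [show s - (F.deg n a - n) = s + n - F.deg n a by ring]
  · rw [F.incl_apply_ne h]
    exact zero_mem _

/-- The degree `j` component of any preimage is again a preimage, since `d` commutes with the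
projections. -/
lemma exists_d_eq {n : ℕ} {j : ℤ} {x : Fin (F.rank n) → R} (hx : x ∈ freeGrading 𝒜 (F.deg n) j)
    (h : ∃ y, F.d n y = x) : ∃ y ∈ freeGrading 𝒜 (F.deg (n + 1)) j, F.d n y = x := by
  obtain ⟨y, rfl⟩ := h
  have hp := isProjections_free 𝒜 (F.deg (n + 1))
  have hq := isProjections_free 𝒜 (F.deg n)
  exact ⟨_, hp.mem j y, (hp.map hq (F.d n).toAddMonoidHom (F.d_homogeneous n) j y).trans
    (hq.same _ _ hx)⟩

lemma exists_aug_eq (hM : DirectSum.IsInternal ℳ) {j : ℤ} {x : M} (hx : x ∈ ℳ j) :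
    ∃ y ∈ freeGrading 𝒜 (F.deg 0) j, F.aug y = x := by
  obtain ⟨y, rfl⟩ := F.aug_surjective x
  have hp := isProjections_free 𝒜 (F.deg 0)
  obtain ⟨q, hq⟩ := exists_isProjections hM
  exact ⟨_, hp.mem j y, (hp.map hq F.aug.toAddMonoidHom F.aug_homogeneous j y).trans
    (hq.same _ _ hx)⟩

/-- Exactness of the augmented resolution, one homological degree at a time, with all preimages
chosen homogeneous. -/
theorem coneExact_augment (hM : DirectSum.IsInternal ℳ) :
    GradedDiff.ConeExact (fun _ => True) (GradedDiff.free F.toFreeData) (F.target hsm)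
      F.augment := by
  intro s _ x hx y hy hdx hxy
  rw [GradedDiff.free_d] at hdx
  have hdx (n : ℕ) : F.d n (F.comp (n + 1) x) = 0 := by
    rw [← F.comp_linearCombination]
    exact (congrArg (F.comp n) hdx).trans (map_zero _)
  have key (n : ℕ) : ∃ z ∈ freeGrading 𝒜 (F.deg (n + 1)) (s + (n + 1 : ℕ)),
      F.d n z = F.comp n x := by
    refine F.exists_d_eq ?_ ?_
    · have := F.comp_mem hx n
      rwa [show s + 1 + (n : ℤ) = s + (n + 1 : ℕ) by push_cast; ring] at this
    · obtain _ | n := n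
      · exact (F.exact_zero _).mp hxy
      · exact (F.exact_succ n _).mp (hdx n)
  choose z hz hdz using key
  obtain ⟨z₀, hz₀, haug⟩ := F.exists_aug_eq hM (show y ∈ ℳ s from hy)
  let N := x.support.sup (fun i => i.1) + 1
  have hN (n : ℕ) (hn : N ≤ n) : F.comp n x = 0 := by
    ext a
    by_contra hne
    have := Finset.le_sup (f := fun i : F.toFreeData.I => i.1) (Finsupp.mem_support_iff.mpr hne)
    exact absurd (this.trans_lt hn) (lt_irrefl _)
  -- Homological degree 0 lifts `y` through the augmentation, and degree `n + 1` lifts the degree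
  -- `n` component of `x`. The module has zero differential, so `y' = 0` suffices.
  refine ⟨F.incl 0 z₀ + ∑ n ∈ Finset.range N, F.incl (n + 1) (z n), ?_, 0, zero_mem _, ?_, ?_⟩
  · refine add_mem (F.incl_mem (by simpa using hz₀)) (sum_mem fun n _ => F.incl_mem (hz n))
  · rw [GradedDiff.free_d]
    refine F.eq_of_comp fun n => (F.comp_linearCombination n _).trans ?_
    rw [map_add, F.comp_incl_ne (Nat.succ_ne_zero n).symm, zero_add, map_sum]
    by_cases hn : n < N
    · rw [Finset.sum_eq_single n, comp_incl, hdz]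
      · exact fun m _ hm => F.comp_incl_ne (by omega) _
      · exact fun h => absurd (Finset.mem_range.mpr hn) h
    · rw [Finset.sum_eq_zero, map_zero, hN n (by omega)]
      intro m hm
      rw [Finset.mem_range] at hm
      exact F.comp_incl_ne (by omega) _
  · rw [map_zero, add_zero]
    refine haug.symm.trans (congrArg F.aug ?_)
    rw [map_add, comp_incl, map_sum, Finset.sum_eq_zero, add_zero]
    exact fun m _ => F.comp_incl_ne (by omega) _

end MinimalGradedFreeResolution

/-! ### Minimal homogeneous generators and graded Nakayama -/

section MinimalCover

variable {k R T : Type*} [Field k] [CommRing R] [AddCommGroup T] [Module k T] [Module R T]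

lemma IsProjections.exists_sum_eq {𝒯 : ℤ → Submodule k T} {p : ℤ → T →ₗ[k] T}
    (hp : IsProjections 𝒯 p) (x : T) : ∃ s : Finset ℤ, ∀ t, s ⊆ t → ∑ j ∈ t, p j x = x := by
  classical
  have hx : x ∈ ⨆ j, 𝒯 j := hp.iSup ▸ Submodule.mem_top
  induction hx using Submodule.iSup_induction' with
  | mem i x hx =>
    refine ⟨{i}, fun t ht => ?_⟩
    rw [Finset.sum_eq_single i (fun j _ hj => hp.ne _ _ _ hj hx)
      (fun h => absurd (ht (Finset.mem_singleton_self i)) h), hp.same _ _ hx]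
  | zero => exact ⟨∅, by simp⟩
  | add x y _ _ hx hy =>
    obtain ⟨s, hs⟩ := hx
    obtain ⟨t, ht⟩ := hy
    refine ⟨s ∪ t, fun u hu => ?_⟩
    simp only [map_add, Finset.sum_add_distrib]
    rw [hs u (Finset.union_subset_left hu), ht u (Finset.union_subset_right hu)]

lemma exists_span_homogeneous {𝒯 : ℤ → Submodule k T} {p : ℤ → T →ₗ[k] T}
    (hp : IsProjections 𝒯 p) {N : Submodule R T} (hN : N.FG) (hNp : ∀ j, ∀ x ∈ N, p j x ∈ N) :
    ∃ (r : ℕ) (deg : Fin r → ℤ) (e : Fin r → T), (∀ a, e a ∈ 𝒯 (deg a)) ∧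
      Submodule.span R (Set.range e) = N := by
  have hspan : Submodule.span R {x | x ∈ N ∧ ∃ j, x ∈ 𝒯 j} = N := by
    refine le_antisymm (Submodule.span_le.mpr fun x hx => hx.1) fun x hx => ?_
    obtain ⟨s, hs⟩ := hp.exists_sum_eq x
    rw [← hs s subset_rfl]
    exact sum_mem fun j _ => Submodule.subset_span ⟨hNp j x hx, j, hp.mem j x⟩
  rw [← hspan] at hN
  obtain ⟨s, hs, hs'⟩ := (Submodule.fg_span_iff_fg_span_finset_subset _).mp hN
  have hdeg (a : Fin s.card) : ∃ j, (s.equivFin.symm a : T) ∈ 𝒯 j :=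
    (hs (s.equivFin.symm a).2).2
  choose deg hdeg using hdeg
  refine ⟨s.card, deg, fun a => s.equivFin.symm a, hdeg, ?_⟩
  rw [← hspan, hs']
  congr 1
  ext x
  exact ⟨fun ⟨a, ha⟩ => ha ▸ (s.equivFin.symm a).2, fun hx => ⟨s.equivFin ⟨x, hx⟩, by simp⟩⟩

variable [Algebra k R] {𝒜 : ℕ → Submodule k R} [GradedAlgebra 𝒜]

/-- A finitely generated graded submodule is the image of a graded free module under a
homogeneous map with kernel contained in `R₊ R^r`. -/
theorem exists_minimal_cover (h0 : 𝒜 0 = 1) {𝒯 : ℤ → Submodule k T} {p : ℤ → T →ₗ[k] T}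
    (hp : IsProjections 𝒯 p)
    (hsm : ∀ {u s : ℤ} {a : R} {x : T}, a ∈ intGrading 𝒜 u → x ∈ 𝒯 s → a • x ∈ 𝒯 (s + u))
    {N : Submodule R T} (hN : N.FG) (hNp : ∀ j, ∀ x ∈ N, p j x ∈ N) :
    ∃ (r : ℕ) (deg : Fin r → ℤ) (f : (Fin r → R) →ₗ[R] T),
      (∀ j x, x ∈ freeGrading 𝒜 deg j → f x ∈ 𝒯 j) ∧ LinearMap.range f = N ∧
      ∀ x, f x = 0 → ∀ b, x b ∈ (HomogeneousIdeal.irrelevant 𝒜).toIdeal := by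
  classical
  -- Take the least possible number `r` of homogeneous generators. A relation with a coordinate
  -- outside `R₊` will make one of them redundant.
  have hex := exists_span_homogeneous hp hN hNp
  obtain ⟨deg, e, he, hspan⟩ := Nat.find_spec hex
  have hmin := fun m hm => Nat.find_min hex (m := m) hm
  generalize Nat.find hex = r at *
  have hf : ∀ j x, x ∈ freeGrading 𝒜 deg j → Fintype.linearCombination R e x ∈ 𝒯 j := by
    intro j x hx
    rw [Fintype.linearCombination_apply]
    refine sum_mem fun a _ => ?_
    have := hsm (hx a trivial) (he a)
    rwa [add_sub_cancel] at this
  refine ⟨r, deg, Fintype.linearCombination R e, hf, ?_, ?_⟩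
  · rw [Fintype.range_linearCombination, hspan]
  intro x hx b
  by_contra hb
  -- The component of the relation in degree `deg b` is again a relation, and its `b`-coordinate is
  -- the degree 0 part of `x b`: a nonzero scalar, since `𝒜 0 = 1`.
  have hq := isProjections_free 𝒜 deg
  have hx' := hq.map hp (Fintype.linearCombination R e).toAddMonoidHom hf (deg b) x
  have hxb := hq.mem (deg b) x b trivial
  set x' := (LinearMap.pi fun a => intProj 𝒜 (deg b - deg a) ∘ₗ LinearMap.proj a) x with hx'def
  have hx'b : x' b = GradedAlgebra.proj 𝒜 0 (x b) := by
    simp [hx'def, sub_self]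
    rfl
  have hx'0 : Fintype.linearCombination R e x' = 0 := by
    refine hx'.trans ?_
    change p (deg b) (Fintype.linearCombination R e x) = 0
    rw [hx, map_zero]
  have hne : x' b ≠ 0 := fun h => hb ((HomogeneousIdeal.mem_irrelevant_iff 𝒜 _).mpr (by
    rw [← h, hx'b]; rfl))
  have hmem : x' b ∈ 𝒜 0 := by rw [hx'b]; exact SetLike.coe_mem _
  rw [h0] at hmem
  obtain ⟨c, hc⟩ := Submodule.mem_one.mp hmem
  have hc0 : c ≠ 0 := by rintro rfl; exact hne (by rw [← hc, map_zero])
  obtain _ | r := r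
  · exact b.elim0
  refine hmin r (Nat.lt_succ_self r) ⟨deg ∘ b.succAbove, e ∘ b.succAbove, fun a => he _, ?_⟩
  rw [← hspan]
  refine le_antisymm (Submodule.span_mono (Set.range_comp_subset_range _ _))
    (Submodule.span_le.mpr ?_)
  rintro _ ⟨a, rfl⟩
  obtain rfl | ⟨a, rfl⟩ := Fin.eq_self_or_eq_succAbove b a
  · rw [Fintype.linearCombination_apply, Fin.sum_univ_succAbove _ a, ← hc] at hx'0
    -- Divide the relation by the scalar `c` to express the omitted generator through the others.
    have hea : e a = algebraMap k R c⁻¹ • -∑ i, x' (a.succAbove i) • e (a.succAbove i) := by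
      rw [← eq_neg_of_add_eq_zero_left hx'0, smul_smul, ← map_mul, inv_mul_cancel₀ hc0, map_one,
        one_smul]
    rw [hea]
    exact Submodule.smul_mem _ _ (neg_mem (sum_mem fun i _ =>
      Submodule.smul_mem _ _ (Submodule.subset_span ⟨i, rfl⟩)))
  · exact Submodule.subset_span ⟨a, rfl⟩

end MinimalCover

/-! ### Existence of minimal graded free resolutions -/

section Existence

variable {k R M : Type*} [Field k] [CommRing R] [Algebra k R]

lemma IsStandardGraded.isNoetherianRing {𝒜 : ℕ → Submodule k R} [GradedAlgebra 𝒜]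
    (h : IsStandardGraded 𝒜) : IsNoetherianRing R := by
  obtain ⟨s, hs⟩ := Module.Finite.iff_fg.mp h.finite_degree_one
  have : Algebra.FiniteType k R := ⟨s, by rw [← Algebra.adjoin_span, hs, h.generated]⟩
  exact Algebra.FiniteType.isNoetherianRing k R

/-- A graded submodule of `R₊ R^r`, where `R^r` carries a grading as a graded free module. -/
structure MinimalSyzygy (𝒜 : ℕ → Submodule k R) [GradedAlgebra 𝒜] where
  rank : ℕ
  deg : Fin rank → ℤ
  ker : Submodule R (Fin rank → R)
  homogeneous : ∀ j, ∀ x ∈ ker, (fun a => intProj 𝒜 (j - deg a) (x a)) ∈ ker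
  minimal : ∀ x ∈ ker, ∀ b, x b ∈ (HomogeneousIdeal.irrelevant 𝒜).toIdeal

variable {𝒜 : ℕ → Submodule k R} [GradedAlgebra 𝒜]

lemma exists_minimalSyzygy {T : Type*} [AddCommGroup T] [Module k T] [Module R T]
    [IsNoetherianRing R] (h0 : 𝒜 0 = 1) {𝒯 : ℤ → Submodule k T} {p : ℤ → T →ₗ[k] T}
    (hp : IsProjections 𝒯 p)
    (hsm : ∀ {u s : ℤ} {a : R} {x : T}, a ∈ intGrading 𝒜 u → x ∈ 𝒯 s → a • x ∈ 𝒯 (s + u))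
    {N : Submodule R T} (hN : N.FG) (hNp : ∀ j, ∀ x ∈ N, p j x ∈ N) :
    ∃ (t : MinimalSyzygy 𝒜) (f : (Fin t.rank → R) →ₗ[R] T),
      (∀ j x, x ∈ freeGrading 𝒜 t.deg j → f x ∈ 𝒯 j) ∧ LinearMap.range f = N ∧
      LinearMap.ker f = t.ker := by
  obtain ⟨r, deg, f, hf, hr, hk⟩ := exists_minimal_cover h0 hp hsm hN hNp
  refine ⟨⟨r, deg, LinearMap.ker f, fun j x hx => ?_, hk⟩, f, hf, hr, rfl⟩
  refine ((isProjections_free 𝒜 deg).map hp f.toAddMonoidHom hf j x).trans ?_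
  rw [show f.toAddMonoidHom x = 0 from hx, map_zero]

lemma MinimalSyzygy.exists_next [IsNoetherianRing R] (h0 : 𝒜 0 = 1) (s : MinimalSyzygy 𝒜) :
    ∃ (t : MinimalSyzygy 𝒜) (f : (Fin t.rank → R) →ₗ[R] (Fin s.rank → R)),
      (∀ j x, x ∈ freeGrading 𝒜 t.deg j → f x ∈ freeGrading 𝒜 s.deg j) ∧
      LinearMap.range f = s.ker ∧ LinearMap.ker f = t.ker := by
  refine exists_minimalSyzygy h0 (isProjections_free 𝒜 s.deg) ?_ (IsNoetherian.noetherian s.ker)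
    s.homogeneous
  intro u j a x ha hx b _
  have := SetLike.GradedMul.mul_mem (A := intGr 𝒜) (hx b trivial) ha
  rw [Pi.smul_apply, smul_eq_mul, mul_comm]
  change _ ∈ intGrading 𝒜 _
  rwa [show j + u - s.deg b = j - s.deg b + u by ring]

/-- Existence of minimal graded free resolutions. -/
theorem exists_minimalGradedFreeResolution [AddCommGroup M] [Module k M] [Module R M]
    (h𝒜 : IsStandardGraded 𝒜) [Module.Finite R M] {ℳ : ℤ → Submodule k M}
    (hℳ : IsGradedModule 𝒜 ℳ) : Nonempty (MinimalGradedFreeResolution 𝒜 ℳ) := by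
  have := h𝒜.isNoetherianRing
  obtain ⟨p, hp⟩ := exists_isProjections hℳ.isInternal
  obtain ⟨s₀, aug, haug, hr, hk⟩ := exists_minimalSyzygy h𝒜.degree_zero hp
    (hℳ.smul_mem_int 𝒜) (N := ⊤) Module.Finite.fg_top (fun _ _ _ => trivial)
  choose next d hd hdr hdk using MinimalSyzygy.exists_next h𝒜.degree_zero
  -- Iterate the minimal cover on syzygies. The image of each `d` is the previous kernel, which lies
  -- in `R₊` coordinatewise; this is minimality.
  let s : ℕ → MinimalSyzygy 𝒜 := Nat.rec s₀ fun _ => next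
  exact ⟨{
    rank := fun n => (s n).rank
    deg := fun n => (s n).deg
    d := fun n => d (s n)
    aug := aug
    d_homogeneous := fun n => hd (s n)
    aug_homogeneous := haug
    aug_surjective := LinearMap.range_eq_top.mp hr
    exact_zero := LinearMap.exact_iff.mpr (hk.trans (hdr s₀).symm)
    exact_succ := fun n => LinearMap.exact_iff.mpr ((hdk (s n)).trans (hdr (s (n + 1))).symm)
    minimal := fun n x => (s n).minimal _ (hdr (s n) ▸ LinearMap.mem_range_self _ x) }⟩

end Existence

/-! ### Base change of based free complexes -/

section BaseChange

variable {R S : Type*} [CommRing R] [CommRing S] {gA : ℤ → AddSubgroup R} {gB : ℤ → AddSubgroup S}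

lemma Finsupp.linearCombination_mapRange {I J : Type*} (f : R →+* S) (m : I → J →₀ R)
    (v : I →₀ R) :
    Finsupp.linearCombination S (fun i => Finsupp.mapRange.addMonoidHom f.toAddMonoidHom (m i))
      (Finsupp.mapRange.addMonoidHom f.toAddMonoidHom v) =
    Finsupp.mapRange.addMonoidHom f.toAddMonoidHom (Finsupp.linearCombination R m v) := by
  induction v using Finsupp.induction_linear with
  | zero => simp
  | add x y hx hy => simp only [map_add, hx, hy]
  | single i a =>
    ext j
    simp [Finsupp.linearCombination_single]

/-- Base change of a complex of based free modules along a homomorphism of graded rings. -/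
noncomputable abbrev FreeData.baseChange (F : FreeData gA) (f : R →+* S)
    (hf : ∀ j a, a ∈ gA j → f a ∈ gB j) : FreeData gB where
  I := F.I
  h := F.h
  σ := F.σ
  m l := Finsupp.mapRange.addMonoidHom f.toAddMonoidHom (F.m l)
  m_mem l i := hf _ _ (F.m_mem l i)
  h_of_ne l i h := F.h_of_ne l i fun h0 => h (by simp [h0])
  m_sq l := by rw [Finsupp.linearCombination_mapRange, F.m_sq, map_zero]

end BaseChange

/-! ### Exactness in high slopes, and the obstruction given by a minimal generator -/

namespace GradedDiff

/-- The zero complex. -/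
def zero {A : Type*} [CommRing A] (gA : ℤ → AddSubgroup A) : GradedDiff gA PUnit :=
  ofModule (fun _ => ⊤) fun _ _ => trivial

/-- Tensoring with a complex of free modules in nonpositive slopes preserves exactness in high
degrees. -/
theorem exact_tw {A X : Type*} [CommRing A] {gA : ℤ → AddSubgroup A} [AddCommGroup X] [Module A X]
    {C : GradedDiff gA X} {r : ℤ}
    (h : ∀ s, r ≤ s → ∀ y ∈ C.gr s, C.d y = 0 → ∃ y' ∈ C.gr (s - 1), y = C.d y') (F : FreeData gA)
    (hF : ∀ i, F.σ i ≤ 0) {s : ℤ} (hs : r ≤ s) {y : F.I →₀ X} (hy : y ∈ (C.tw F).gr s)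
    (hdy : (C.tw F).d y = 0) : ∃ y' ∈ (C.tw F).gr (s - 1), y = (C.tw F).d y' := by
  have hφ : IsChainMap (zero gA) C 0 :=
    ⟨fun _ => (map_zero C.d).symm, fun _ => (map_zero C.ε).symm, fun _ => zero_mem _⟩
  have he : ConeExact (r ≤ ·) (zero gA) C 0 := by
    intro s hs x _ y hy _ hxy
    obtain ⟨y', hy', e⟩ := h s hs y hy hxy.symm
    exact ⟨0, zero_mem _, y', hy', Subsingleton.elim _ _, by simpa using e⟩
  -- Exactness of `C` is exactness of the cone of `0 → C`. The condition `r ≤ s` survives the shift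
  -- to `s - F.σ i` because `F.σ i ≤ 0`.
  obtain ⟨x', -, y', hy', -, e⟩ := he.tw hφ F (fun i s hs => by have := hF i; omega) s hs 0
    (zero_mem _) y hy (map_zero _) (by rw [hdy]; exact map_zero _)
  refine ⟨y', hy', ?_⟩
  rw [e, Subsingleton.elim x' 0, map_zero, zero_add]

variable {A X N : Type*} [CommRing A] {gA : ℤ → AddSubgroup A} [AddCommGroup X] [Module A X]
  [AddCommGroup N] [Module A N]

lemma isChainMap_lsingle (C : GradedDiff gA X) (Q : FreeData gA) {q : Q.I} (hq : Q.h q = 0)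
    (hσ : Q.σ q = 0) : IsChainMap C (C.tw Q) (Finsupp.lsingle q) where
  map_d x := by
    have : Q.m q = 0 := by
      ext i
      by_contra h
      have := Q.h_of_ne q i h
      omega
    simp [tw_d_single, this, act]
  map_ε x := by simp [tw_ε_single, hq]
  map_mem {s x} hx := C.single_mem_twGr Q (by rwa [hσ, sub_zero])

section Coefficient

variable {G K Q : FreeData gA} (ψ : (K.I →₀ A) →ₗ[A] N) (q : Q.I) (g : G.I)

/-- The coefficient at `q` and `g` of an element of `G ⊗ Q ⊗ K`, augmented along `K → N`. -/
noncomputable def coeffAug : (K.I →₀ Q.I →₀ G.I →₀ A) →ₗ[A] N :=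
  Finsupp.lsum A fun j => LinearMap.toSpanSingleton A N (ψ (Finsupp.single j 1)) ∘ₗ
    Finsupp.lapply g ∘ₗ Finsupp.lapply q

lemma coeffAug_single (j : K.I) (w : Q.I →₀ G.I →₀ A) :
    coeffAug ψ q g (Finsupp.single j w) = w q g • ψ (Finsupp.single j 1) := by
  rw [coeffAug, Finsupp.lsum_single]
  rfl

lemma coeffAug_act (v : K.I →₀ A) (w : Q.I →₀ G.I →₀ A) :
    coeffAug ψ q g (act v w) = w q g • ψ v := by
  induction v using Finsupp.induction_linear with
  | zero => simp [act]
  | add v v' hv hv' => simp only [act, map_add, LinearMap.add_apply, smul_add] at *; rw [hv, hv']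
  | single j a =>
    have : act (Finsupp.single j a) w = a • Finsupp.single j w := by
      rw [act, Finsupp.linearCombination_single]; rfl
    rw [this, map_smul, coeffAug_single, smul_comm, ← map_smul ψ a]
    simp

variable [SetLike.GradedMul gA]

/-- The differential has three parts: the entries of `G` and `Q` annihilate `N`, and `ψ` kills the
boundaries of `K` because `C'` has zero differential. -/
lemma coeffAug_d {C' : GradedDiff gA N} (hψ : IsChainMap (free K) C' ψ) (hC' : C'.d = 0)
    (hG : ∀ i j, ∀ x : N, G.m i j • x = 0) (hQ : ∀ i j, ∀ x : N, Q.m i j • x = 0)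
    (u : K.I →₀ Q.I →₀ G.I →₀ A) : coeffAug ψ q g ((((free G).tw Q).tw K).d u) = 0 := by
  have hdG (x : G.I →₀ A) (n : N) : (free G).d x g • n = 0 := by
    rw [free_d]
    induction x using Finsupp.induction_linear with
    | zero => simp
    | add x y hx hy => simp [add_smul, hx, hy]
    | single i a => simp [Finsupp.linearCombination_single, mul_smul, hG]
  have hdQ (w : Q.I →₀ G.I →₀ A) (n : N) : ((free G).tw Q).d w q g • n = 0 := by
    induction w using Finsupp.induction_linear with
    | zero => simp
    | add x y hx hy => simp [add_smul, hx, hy]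
    | single i x =>
      rw [tw_d_single, Finsupp.add_apply, Finsupp.add_apply, add_smul, act_apply,
        Finsupp.smul_apply, smul_eq_mul, mul_smul, hQ, add_zero]
      by_cases h : i = q
      · subst h
        rw [Finsupp.single_eq_same, hdG]
      · rw [Finsupp.single_eq_of_ne' h]; simp
  have hm (j : K.I) : ψ (K.m j) = 0 := by
    have := hψ.map_d (Finsupp.single j 1)
    rwa [free_d, Finsupp.linearCombination_single, one_smul, hC', LinearMap.zero_apply] at this
  induction u using Finsupp.induction_linear with
  | zero => simp
  | add x y hx hy => simp [hx, hy]
  | single j w =>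
    rw [tw_d_single, map_add, coeffAug_single, coeffAug_act, hm, hdQ, smul_zero, add_zero]

/-- The swap signs disappear: `ψ` commutes with `ε`, which is the identity on `N`, so `(-1) ^ K.h j`
acts trivially on the image of the `j`-th basis vector. -/
lemma coeffAug_swap {C' : GradedDiff gA N} (hψ : IsChainMap (free K) C' ψ)
    (hε : C'.ε = LinearMap.id) (x : G.I →₀ K.I →₀ A) :
    coeffAug ψ q g (Finsupp.mapRange.linearMap (Finsupp.lsingle (R := A) q) (swap G K x)) = ψ (x g) := by
  have hsign (j : K.I) : (-1 : A) ^ K.h j • ψ (Finsupp.single j 1) = ψ (Finsupp.single j 1) := by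
    have := hψ.map_ε (Finsupp.single j 1)
    rwa [tw_ε_single, map_smul, hε] at this
  have hsign' (j : K.I) (n : ℕ) :
      (-1 : A) ^ (n * K.h j) • ψ (Finsupp.single j 1) = ψ (Finsupp.single j 1) := by
    induction n with
    | zero => simp
    | succ n ih => rw [add_mul, one_mul, pow_add, mul_smul, hsign, ih]
  induction x using induction_single with
  | h0 => simp
  | ha x y hx hy => simp only [map_add, hx, hy, Finsupp.add_apply]
  | hs i j a =>
    rw [swap_single, map_smul, map_smul, Finsupp.mapRange.linearMap_apply,
      Finsupp.mapRange_single, coeffAug_single, smul_comm, hsign', Finsupp.lsingle_apply,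
      Finsupp.single_eq_same]
    by_cases h : i = g
    · subst h
      rw [Finsupp.single_eq_same, Finsupp.single_eq_same, ← map_smul]
      simp
    · simp [Finsupp.single_eq_of_ne' h]

end Coefficient

/-- If `G` is a minimal resolution of `C`, `K` a linear resolution of the residue module `C'`, and
`Q` a minimal complex starting with a generator of degree `0`, then `C ⊗ Q` is not exact in all
degrees from the degree of a generator of `G` on. -/
theorem not_exact [SetLike.GradedMul gA] {G K Q : FreeData gA} {C : GradedDiff gA X}
    {C' : GradedDiff gA N}
    {φ : (G.I →₀ A) →ₗ[A] X} {ψ : (K.I →₀ A) →ₗ[A] N}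
    (hφ : IsChainMap (free G) C φ) (hψ : IsChainMap (free K) C' ψ)
    (hφe : ConeExact (fun _ => True) (free G) C φ) (hψe : ConeExact (fun _ => True) (free K) C' ψ)
    (hd : C'.d = 0) (hε : C'.ε = LinearMap.id)
    (hG : ∀ i j, ∀ x : N, G.m i j • x = 0) (hQ : ∀ i j, ∀ x : N, Q.m i j • x = 0)
    (hK : ∀ i, K.σ i ≤ 0) {q : Q.I} (hq : Q.h q = 0) (hσ : Q.σ q = 0) (g : G.I)
    {n : N} (hn : n ∈ C'.gr 0) (hn0 : n ≠ 0) :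
    ¬ ∀ s, G.σ g ≤ s → ∀ y ∈ (C.tw Q).gr s, (C.tw Q).d y = 0 →
      ∃ y' ∈ (C.tw Q).gr (s - 1), y = (C.tw Q).d y' := by
  intro hex
  -- Minimality of `G`: the complex `N ⊗ G` has zero differential, so `n` placed at `g` is a cycle
  -- and lifts exactly to a cycle `x` of `K ⊗ G`.
  have hD (y : G.I →₀ N) : (C'.tw G).d y = 0 := by
    induction y using Finsupp.induction_linear with
    | zero => simp
    | add x y hx hy => simp [hx, hy]
    | single i y => ext j; simp [tw_d_single, hd, hG]
  obtain ⟨x, hx, y', -, hdx, e⟩ := hψe.tw hψ G (fun _ _ _ => trivial) (G.σ g) trivial 0 (zero_mem _)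
    (Finsupp.single g n) (C'.single_mem_twGr G (by simpa using hn)) (by simp) (by rw [hD, map_zero])
  rw [hD, add_zero] at e
  have hι := (isChainMap_lsingle (free G) Q hq hσ).tw K
  have hφQ := hφ.tw Q
  set z := Finsupp.mapRange.linearMap (Finsupp.lsingle (R := A) q) (swap G K x) with hz
  have hdz : (((free G).tw Q).tw K).d z = 0 := by
    rw [hz, ← hι.map_d, ← swap_d, hdx, map_zero, map_zero]
  have hzm : z ∈ (((free G).tw Q).tw K).gr (G.σ g) := hι.map_mem (swap_mem G K hx)
  -- The image of `z` in `C ⊗ Q ⊗ K` is a boundary by the assumed exactness; the quasi-isomorphism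
  -- from `G ⊗ Q ⊗ K` then makes `z` itself a boundary.
  obtain ⟨w, hw, hw'⟩ := exact_tw hex K hK le_rfl ((hφQ.tw K).map_mem hzm)
    (by rw [← (hφQ.tw K).map_d, hdz, map_zero])
  obtain ⟨u, -, -, -, hu, -⟩ := (hφe.tw hφ Q (fun _ _ _ => trivial)).tw hφQ K
    (fun _ _ _ => trivial) (G.σ g - 1) trivial z (by simpa using hzm) w hw hdz hw'
  -- The functional vanishes on the boundary `z`, yet its value there is `ψ (x g) = n`.
  have h1 := coeffAug_d ψ q g hψ hd hG hQ u
  rw [hu, hz, coeffAug_swap ψ q g hψ hε] at h1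
  have h2 := DFunLike.congr_fun e g
  rw [Finsupp.single_eq_same, Finsupp.mapRange.linearMap_apply, Finsupp.mapRange_apply, h1] at h2
  exact hn0 h2

end GradedDiff

/-! ### Regularity in terms of slopes -/

section Regularity

variable {k R M : Type*} [Field k] [CommRing R] [Algebra k R] [AddCommGroup M] [Module k M]
  [Module R M] {𝒜 : ℕ → Submodule k R} [GradedAlgebra 𝒜] {ℳ : ℤ → Submodule k M}

/-- `regularity` is a supremum over all minimal resolutions, so any single one bounds it from below,
while an upper bound must be checked on each. Uniqueness of minimal resolutions is thereby avoided.
-/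
lemma MinimalGradedFreeResolution.slope_le_regularity (F : MinimalGradedFreeResolution 𝒜 ℳ)
    (i : F.toFreeData.I) : (((F.toFreeData.σ i : ℤ) : ℝ) : EReal) ≤ regularity 𝒜 ℳ := by
  refine le_sSup ⟨F, i.1, F.deg i.1 i.2, ?_, rfl⟩
  exact Finset.card_ne_zero_of_mem (Finset.mem_filter.mpr ⟨Finset.mem_univ i.2, rfl⟩)

lemma regularity_le {t : EReal} (h : ∀ (F : MinimalGradedFreeResolution 𝒜 ℳ) (i : F.toFreeData.I),
    (((F.toFreeData.σ i : ℤ) : ℝ) : EReal) ≤ t) : regularity 𝒜 ℳ ≤ t := by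
  refine sSup_le ?_
  rintro _ ⟨F, i, j, hF, rfl⟩
  obtain ⟨a, ha⟩ := Finset.card_ne_zero.mp hF
  obtain rfl := (Finset.mem_filter.mp ha).2
  exact h F ⟨i, a⟩

/-- The supremum of the empty set is `⊥`, so a finite regularity of the residue field already
provides a resolution of it. -/
lemma nonempty_of_regularity_ne_bot (h : regularity 𝒜 ℳ ≠ ⊥) :
    Nonempty (MinimalGradedFreeResolution 𝒜 ℳ) := by
  by_contra hF
  rw [not_nonempty_iff] at hF
  exact h (le_bot_iff.mp (regularity_le fun F => hF.elim F))

end Regularity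

/-! ### The residue field and its degree-zero generator -/

section Residue

variable {k R : Type*} [Field k] [CommRing R] [Algebra k R] {𝒜 : ℕ → Submodule k R}
  [GradedAlgebra 𝒜]

lemma residueGrading_isInternal : DirectSum.IsInternal (residueGrading 𝒜) := by
  rw [DirectSum.isInternal_submodule_iff_iSupIndep_and_iSup_eq_top]
  constructor
  · intro j
    by_cases hj : j = 0
    · subst hj
      have : ⨆ i, ⨆ (_ : i ≠ (0 : ℤ)), residueGrading 𝒜 i = ⊥ := by
        simp only [iSup_eq_bot]
        exact fun i hi => if_neg hi
      rw [this]
      exact disjoint_bot_right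
    · rw [show residueGrading 𝒜 j = ⊥ from if_neg hj]
      exact disjoint_bot_left
  · exact eq_top_iff.mpr (le_iSup_of_le 0 (if_pos rfl).ge)

lemma one_notMem_irrelevant [Nontrivial R] : (1 : R) ∉ (HomogeneousIdeal.irrelevant 𝒜).toIdeal := by
  intro h
  have h1 := (HomogeneousIdeal.mem_irrelevant_iff 𝒜 _).mp h
  have : GradedAlgebra.proj 𝒜 0 (1 : R) = 1 :=
    DirectSum.decompose_of_mem_same 𝒜 (SetLike.GradedOne.one_mem (A := 𝒜))
  exact one_ne_zero (this.symm.trans h1)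

/-- A minimal resolution of the residue field starts with a generator of degree zero. -/
lemma MinimalGradedFreeResolution.exists_generator [Nontrivial R]
    (Q : MinimalGradedFreeResolution 𝒜 (residueGrading 𝒜)) :
    ∃ q : Q.toFreeData.I, Q.toFreeData.h q = 0 ∧ Q.toFreeData.σ q = 0 := by
  have : ∃ a, Q.aug (Pi.single a 1) ≠ 0 := by
    by_contra! h
    have h0 : Q.aug = 0 := LinearMap.pi_ext' fun a => LinearMap.ext_ring (h a)
    obtain ⟨x, hx⟩ := Q.aug_surjective (Ideal.Quotient.mk _ 1)
    rw [h0, LinearMap.zero_apply] at hx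
    exact one_notMem_irrelevant (Ideal.Quotient.eq_zero_iff_mem.mp hx.symm)
  obtain ⟨a, ha⟩ := this
  refine ⟨⟨0, a⟩, rfl, ?_⟩
  have hmem := Q.aug_homogeneous _ _ (single_mem_freeGrading 𝒜 (Q.deg 0) a)
  by_contra hne
  have hdeg : Q.deg 0 a ≠ 0 := fun h => hne (by simp [h])
  rw [show residueGrading 𝒜 (Q.deg 0 a) = ⊥ from if_neg hdeg] at hmem
  exact ha ((Submodule.mem_bot k).mp hmem)

end Residue

/-! ### Passing between the two rings -/

section RestrictScalars

variable {k R S M : Type*} [Field k] [CommRing R] [CommRing S] [Algebra k R] [Algebra k S]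
  [Algebra R S] [AddCommGroup M] [Module k M] [Module R M] [Module S M] [IsScalarTower R S M]
  {𝒜 : ℕ → Submodule k R} {ℬ : ℕ → Submodule k S}

lemma algebraMap_mem_intGr (hhom : ∀ (i : ℕ) (a : R), a ∈ 𝒜 i → algebraMap R S a ∈ ℬ i) (j : ℤ)
    (a : R) (ha : a ∈ intGr 𝒜 j) : algebraMap R S a ∈ intGr ℬ j := by
  obtain hj | hj := lt_or_ge j 0
  · rw [eq_zero_of_mem_intGrading 𝒜 hj ha, map_zero]; exact zero_mem _
  · lift j to ℕ using hj
    exact hhom j a ha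

lemma IsGradedModule.restrictScalars {ℳ : ℤ → Submodule k M} (h : IsGradedModule ℬ ℳ)
    (hhom : ∀ (i : ℕ) (a : R), a ∈ 𝒜 i → algebraMap R S a ∈ ℬ i) : IsGradedModule 𝒜 ℳ where
  isInternal := h.isInternal
  smul_mem i j a x ha hx := by
    rw [← algebraMap_smul S a x]
    exact h.smul_mem i j _ x (hhom i a ha) hx

/-- This keeps the base change to `S` of a minimal complex over `R` minimal. -/
lemma algebraMap_mem_irrelevant [GradedAlgebra 𝒜] [GradedAlgebra ℬ]
    (hhom : ∀ (i : ℕ) (a : R), a ∈ 𝒜 i → algebraMap R S a ∈ ℬ i) {a : R}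
    (ha : a ∈ (HomogeneousIdeal.irrelevant 𝒜).toIdeal) :
    algebraMap R S a ∈ (HomogeneousIdeal.irrelevant ℬ).toIdeal := by
  classical
  rw [← DirectSum.sum_support_decompose 𝒜 a, map_sum]
  refine sum_mem fun i _ => ?_
  by_cases hi : i = 0
  · subst hi
    have : (DirectSum.decompose 𝒜 a 0 : R) = 0 := (HomogeneousIdeal.mem_irrelevant_iff 𝒜 a).mp ha
    rw [this, map_zero]
    exact zero_mem _
  · exact HomogeneousIdeal.mem_irrelevant_of_mem ℬ (Nat.pos_of_ne_zero hi)
      (hhom i _ (SetLike.coe_mem _))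

/-- Base change does not change the differential on the tensor product with a module. -/
lemma tw_baseChange_d {gA : ℤ → AddSubgroup R} {gB : ℤ → AddSubgroup S} (C : GradedDiff gA M)
    (C' : GradedDiff gB M) (hd : ∀ x, C.d x = C'.d x) (hε : ∀ x, C.ε x = C'.ε x)
    (Q : FreeData gA) (hf : ∀ j a, a ∈ gA j → algebraMap R S a ∈ gB j) (x : Q.I →₀ M) :
    (C'.tw (Q.baseChange (algebraMap R S) hf)).d x = (C.tw Q).d x := by
  induction x using Finsupp.induction_linear with
  | zero => rw [map_zero, map_zero]
  | add x y hx hy => rw [map_add, map_add, hx, hy]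
  | single i x =>
    rw [C'.tw_d_single (Q.baseChange (algebraMap R S) hf) i x, C.tw_d_single, hd, hε]
    congr 1
    ext j
    rw [GradedDiff.act_apply, GradedDiff.act_apply]
    exact algebraMap_smul S _ _

end RestrictScalars

theorem mainTheorem8 {k R S M : Type*} [Field k] [CommRing R] [CommRing S]
    [Algebra k R] [Algebra k S] [Algebra R S] [IsScalarTower k R S]
    (𝒜 : ℕ → Submodule k R) (ℬ : ℕ → Submodule k S) [GradedAlgebra 𝒜] [GradedAlgebra ℬ]
    (hR : IsKoszulAlgebra 𝒜) (hS : IsKoszulAlgebra ℬ)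
    (hhom : ∀ (i : ℕ) (a : R), a ∈ 𝒜 i → algebraMap R S a ∈ ℬ i)
    (hfin : Module.Finite R S)
    [AddCommGroup M] [Module k M] [Module R M] [Module S M]
    [IsScalarTower k S M] [IsScalarTower R S M]
    (hM : Module.Finite S M)
    (ℳ : ℤ → Submodule k M) (hℳ : IsGradedModule ℬ ℳ) :
    regularity ℬ ℳ ≤ regularity 𝒜 ℳ := by
  have := hR.standard.nontrivial
  have := hS.standard.nontrivial
  have : Module.Finite R M := Module.Finite.trans S M
  have hℳR : IsGradedModule 𝒜 ℳ := hℳ.restrictScalars hhom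
  obtain ⟨P⟩ := exists_minimalGradedFreeResolution hR.standard hℳR
  obtain ⟨Q⟩ := nonempty_of_regularity_ne_bot (𝒜 := 𝒜) (ℳ := residueGrading 𝒜)
    (by rw [hR.regularity_residue]; exact EReal.zero_ne_bot)
  obtain ⟨K⟩ := nonempty_of_regularity_ne_bot (𝒜 := ℬ) (ℳ := residueGrading ℬ)
    (by rw [hS.regularity_residue]; exact EReal.zero_ne_bot)
  have hK (i) : K.toFreeData.σ i ≤ 0 := by
    have := K.slope_le_regularity i
    rw [hS.regularity_residue] at this
    exact_mod_cast this
  obtain ⟨q, hq, hσ⟩ := Q.exists_generator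
  refine regularity_le fun G g => ?_
  by_contra! hlt
  -- The strict inequality is what makes `k ⊗ P` vanish from the slope of `g` on.
  have hP (i) : P.toFreeData.σ i < G.toFreeData.σ g := by
    have := (P.slope_le_regularity i).trans_lt hlt
    exact_mod_cast this
  have hone : (1 : S ⧸ (HomogeneousIdeal.irrelevant ℬ).toIdeal) ≠ 0 := fun h =>
    one_notMem_irrelevant (𝒜 := ℬ) (Ideal.Quotient.eq_zero_iff_mem.mp h)
  have hf := algebraMap_mem_intGr (𝒜 := 𝒜) (ℬ := ℬ) hhom
  refine GradedDiff.not_exact (Q := Q.toFreeData.baseChange (algebraMap R S) hf)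
    (G.isChainMap_augment (hℳ.smul_mem_int ℬ)) (K.isChainMap_augment (residueGrading_smul_mem ℬ))
    (G.coneExact_augment _ hℳ.isInternal) (K.coneExact_augment _ residueGrading_isInternal)
    rfl rfl (fun i j => smul_residue_eq_zero ℬ (G.matrix_mem_irrelevant i j))
    (fun i j => smul_residue_eq_zero ℬ
      (algebraMap_mem_irrelevant hhom (Q.matrix_mem_irrelevant i j)))
    hK hq hσ g (n := 1) (show (1 : S ⧸ _) ∈ residueGrading ℬ 0 by
      rw [show residueGrading ℬ 0 = ⊤ from if_pos rfl]; trivial) hone ?_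
  intro s hs y hy hdy
  -- Identify M ⊗_S (S ⊗_R Q) with M ⊗_R Q, so that exactness can be checked over `R`.
  have hdeq := tw_baseChange_d (P.target (hℳR.smul_mem_int 𝒜)) (G.target (hℳ.smul_mem_int ℬ))
    (fun _ => rfl) (fun _ => rfl) Q.toFreeData hf
  obtain ⟨y', hy', e⟩ := GradedDiff.exact_of_balance
    (P.isChainMap_augment (hℳR.smul_mem_int 𝒜)) (Q.isChainMap_augment (residueGrading_smul_mem 𝒜))
    (P.coneExact_augment _ hℳR.isInternal) (Q.coneExact_augment _ residueGrading_isInternal)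
    -- The coordinate at `i` has degree `s - σ i > 0`, where the residue field is zero.
    (s := s) (fun z hz => Finsupp.ext fun i => by
      have h : z i ∈ residueGrading 𝒜 (s - P.toFreeData.σ i) := hz i
      have hi := hP i
      rw [show residueGrading 𝒜 (s - P.toFreeData.σ i) = ⊥ from if_neg (by omega)] at h
      exact (Submodule.mem_bot k).mp h) hy ((hdeq y).symm.trans hdy)
  exact ⟨y', hy', e.trans (hdeq y').symm⟩
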